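/- Let $n\in\mathbb N$, let $\mathbb F_n^+$ be the unital free semigroup on generators $g_1,\dots,g_n$ with identity $g_0$ and length $|\cdot|$, and let $F^2(H_n)$ be the full Fock space with orthonormal basis $\{e_\alpha\}_{\alpha\in\mathbb F_n^+}$. For operators $T=(T_1,\dots,T_n)$ put $T_\alpha=T_{i_1}\cdots T_{i_p}$ if $\alpha=g_{i_1}\cdots g_{i_p}$, $T_{g_0}=I$, and let $r(T)=\lim_{k\to\infty}\big\|\sum_{|\alpha|=k}T_\alpha T_\alpha^*\big\|^{1/2k}$ be the joint spectral radius. For weights $\boldsymbol\mu=\{\mu_\beta\}_{\beta\in\mathbb F_n^+}$ with $\mu_\beta>0$ and $\mu_{g_0}=1$ put $\boldsymbol\mu(\alpha,g_0)=\mu_{g_{i_1}\cdots g_{i_p}}\mu_{g_{i_2}\cdots g_{i_p}}\cdots\mu_{g_{i_p}}$ for $\alpha=g_{i_1}\cdots g_{i_p}$, and $\boldsymbol\mu(g_0,g_0)=1$. The weighted left multi-shift is $W=(W_1,\dots,W_n)$ on $F^2(H_n)$, $W_ie_\alpha=\mu_{g_i\alpha}e_{g_i\alpha}$. Let $F^2(\boldsymbol\mu)$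 be the Hilbert space of formal power series $\sum c_\alpha Z_\alpha$ in noncommuting indeterminates $Z_1,\dots,Z_n$ with $\sum\boldsymbol\mu(\alpha,g_0)^2|c_\alpha|^2<\infty$, let $U:F^2(H_n)\to F^2(\boldsymbol\mu)$ be the unitary $Ue_\alpha=\boldsymbol\mu(\alpha,g_0)^{-1}Z_\alpha$, and let $$F^\infty(\boldsymbol\mu)=\{\varphi(W):=U^*L_\varphi U:\ \varphi \text{ a left multiplier of } F^2(\boldsymbol\mu)\}\subset B(F^2(H_n)),$$ where $L_\varphi\zeta=\varphi\zeta$. If $\varphi=\sum c_\alpha Z_\alpha$, then $\sum c_\alpha W_\alpha$ is called the Fourier representation of $\varphi(W)$. **Theorem.** Let $\mathcal H$ be a complex Hilbert space and $T=(T_1,\dots,T_n)\in B(\mathcal H)^n$. Then there are weights $\boldsymbol\mu$ as above with $$\sup_{\alpha}\mu_{g_i\alpha}<\infty\quad\text{and}\quad \sup_\alpha\frac{\boldsymbol\mu(\alpha g_i,g_0)}{\boldsymbol\mu(\alpha,g_0)}<\infty\qquad(1\le i\le n)$$ (that is, the weighted left and right multi-shifts are bounded) such that the weighted left multi-shift $W$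 associated with $\boldsymbol\mu$ satisfies $r(W)=r(T)$ and, for every $\varphi(W)\in F^\infty(\boldsymbol\mu)$ with Fourier representation $\sum c_\alpha W_\alpha$, the limit $$\Psi_T(\varphi(W))=\varphi(T):=\text{SOT-}\lim_{N\to\infty}\sum_{|\alpha|\le N}\Big(1-\frac{|\alpha|}{N+1}\Big)c_\alpha T_\alpha$$ exists and defines a map $\Psi_T:F^\infty(\boldsymbol\mu)\to B(\mathcal H)$ with the following properties. 1. $\Psi_T\big(\sum_{|\alpha|\le m}c_\alpha W_\alpha\big)=\sum_{|\alpha|\le m}c_\alpha T_\alpha$ for all $m$ and all $c_\alpha\in\mathbb C$. 2. $\Psi_T$ is sequentially WOT-continuous and sequentially SOT-continuous. 3. $\Psi_T$ is a completely bounded unital algebra homomorphism, the series $\sum_{\alpha}\boldsymbol\mu(\alpha,g_0)^{-2}T_\alpha T_\alpha^*$ converges in the strong operator topology, and $\|\Psi_T\|_{cb}\le\big\|\sum_{\alpha}\boldsymbol\mu(\alpha,g_0)^{-2}T_\alpha T_\alpha^*\big\|^{1/2}$. 4. $\Psi_T$ is $w^*$-continuous. 5. $r(\varphi(T))\le r(\varphi(W))$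 for every $\varphi(W)\in F^\infty(\boldsymbol\mu)$, where $r(X)$ is the spectral radius of the operator $X$. 6. $\|\Psi_T\|_{cb}\le\frac{\pi}{\sqrt6}$. 7. If $T$ is nilpotent of order $m\ge1$ (that is, $T_\alpha=0$ whenever $|\alpha|=m$, and $T_\beta\ne0$ for some $|\beta|=m-1$), then $\|\Psi_T\|_{cb}\le\Big(\sum_{k=0}^{m-1}\frac1{(k+1)^2}\Big)^{1/2}$. -/

import Mathlib

open Filter Topology
open scoped ENNReal InnerProductSpace

noncomputable section

namespace MultiShift

/-! ### Words, the Fock space, weights -/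

/-- The unital free semigroup on `n` generators: words in the letters `0, …, n-1`.
The empty word is the identity, `α ++ β` is the product, `List.length` is the length. -/
abbrev Word (n : ℕ) : Type := List (Fin n)

/-- The finite set of all words of length `k`. -/
def wordsOfLength (n k : ℕ) : Finset (Word n) :=
  (Finset.univ : Finset (Fin k → Fin n)).map ⟨List.ofFn, List.ofFn_injective⟩

theorem mem_wordsOfLength {n k : ℕ} {α : Word n} :
    α ∈ wordsOfLength n k ↔ α.length = k := by
  constructor
  · intro h
    obtain ⟨f, -, rfl⟩ := Finset.mem_map.1 h
    simp
  · rintro rfl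
    exact Finset.mem_map.2 ⟨α.get, Finset.mem_univ _, List.ofFn_get α⟩

/-- The full Fock space of `ℂⁿ`, presented through its orthonormal basis indexed by words,
that is, as the space of square summable families indexed by words. -/
abbrev Fock (n : ℕ) : Type := lp (fun _ : Word n => ℂ) 2

/-- The orthonormal basis vector `e_α`. -/
def basisVec {n : ℕ} (α : Word n) : Fock n := lp.single 2 α (1 : ℂ)

/-- The product `μ_{i₁ ⋯ i_p} μ_{i₂ ⋯ i_p} ⋯ μ_{i_p}` attached to the word `i₁ ⋯ i_p`
(equal to `1` at the empty word). -/
def weightProd {n : ℕ} (μ : Word n → ℝ) : Word n → ℝ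
  | [] => 1
  | i :: β => μ (i :: β) * weightProd μ β

/-- Strictly positive weights, equal to `1` at the empty word, for which the weighted left and the
weighted right multi-shift are bounded. -/
structure IsAdmissibleWeight {n : ℕ} (μ : Word n → ℝ) : Prop where
  pos : ∀ β, 0 < μ β
  one : μ [] = 1
  left_bounded : ∀ i : Fin n, BddAbove (Set.range fun α : Word n => μ (i :: α))
  right_bounded : ∀ i : Fin n,
    BddAbove (Set.range fun α : Word n => weightProd μ (α ++ [i]) / weightProd μ α)

/-- `W` is the weighted left multi-shift with weights `μ`: `W_i e_α = μ_{iα} e_{iα}`. -/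
def IsWeightedLeftMultiShift {n : ℕ} (μ : Word n → ℝ) (W : Fin n → Fock n →L[ℂ] Fock n) : Prop :=
  ∀ (i : Fin n) (α : Word n), W i (basisVec α) = (μ (i :: α) : ℂ) • basisVec (i :: α)

/-! ### Tuples of operators -/

section Tuples

variable {H : Type*} [NormedAddCommGroup H] [InnerProductSpace ℂ H]

/-- `T_α = T_{i₁} ⋯ T_{i_p}` for the word `α = i₁ ⋯ i_p`; the identity for the empty word. -/
def wordOp {n : ℕ} (T : Fin n → H →L[ℂ] H) (α : Word n) : H →L[ℂ] H := (α.map T).prod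

/-- `r` is the joint spectral radius of `T`:
the limit of `‖∑_{|α|=k} T_α T_α^*‖ ^ (1/2k)` as `k → ∞`. -/
def HasJointSpectralRadius [CompleteSpace H] {n : ℕ} (T : Fin n → H →L[ℂ] H) (r : ℝ) : Prop :=
  Tendsto (fun k : ℕ =>
    ‖∑ α ∈ wordsOfLength n k, wordOp T α * ContinuousLinearMap.adjoint (wordOp T α)‖
      ^ (1 / (2 * (k : ℝ)))) atTop (𝓝 r)

/-- `T` is nilpotent of order `m`: all products of length `m` vanish, while some product of
length `m - 1` does not. -/
def IsNilpotentOfOrder {n : ℕ} (T : Fin n → H →L[ℂ] H) (m : ℕ) : Prop :=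
  (∀ α : Word n, α.length = m → wordOp T α = 0) ∧
    ∃ β : Word n, β.length + 1 = m ∧ wordOp T β ≠ 0

/-- The polynomial `∑_{|α| ≤ m} c_α T_α`. -/
def polyOp {n : ℕ} (T : Fin n → H →L[ℂ] H) (c : Word n → ℂ) (m : ℕ) : H →L[ℂ] H :=
  ∑ k ∈ Finset.range (m + 1), ∑ α ∈ wordsOfLength n k, c α • wordOp T α

/-- The Cesàro mean `∑_{|α| ≤ N} (1 - |α|/(N+1)) c_α T_α`. -/
def cesaroMean {n : ℕ} (T : Fin n → H →L[ℂ] H) (c : Word n → ℂ) (N : ℕ) : H →L[ℂ] H :=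
  polyOp T (fun α => (1 - (α.length : ℂ) / ((N : ℂ) + 1)) * c α) N

end Tuples

/-! ### Formal power series and the noncommutative Hardy algebra -/

/-- Formal power series `∑ c_α Z_α` in `n` noncommuting indeterminates. -/
abbrev Series (n : ℕ) : Type := Word n → ℂ

/-- The product of formal power series: the coefficient of `Z_γ` in `φ ζ` is the sum of
`φ_α ζ_β` over all factorizations `γ = α β`. -/
def seriesMul {n : ℕ} (φ ζ : Series n) : Series n := fun γ =>
  ∑ k ∈ Finset.range (γ.length + 1), φ (γ.take k) * ζ (γ.drop k)

/-- The map `U`, `e_α ↦ Z_α / μ(α)` with `μ(α) = weightProd μ α`. For positive weights it is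
unitary from the Fock space onto the Hilbert space `F²(μ)` of series with
`∑ μ(α)² |c_α|² < ∞`. -/
def toSeries {n : ℕ} (μ : Word n → ℝ) (f : Fock n) : Series n := fun α => f α / (weightProd μ α : ℂ)

/-- `A = U* L_φ U` where `L_φ` is left multiplication by the series `φ = ∑ c_α Z_α` on `F²(μ)`;
in particular `φ` maps `F²(μ)` into itself. In other words `A = φ(W)`, with Fourier
representation `∑ c_α W_α`. -/
def HasFourierSeries {n : ℕ} (μ : Word n → ℝ) (A : Fock n →L[ℂ] Fock n) (c : Series n) : Prop :=
  ∀ f : Fock n, toSeries μ (A f) = seriesMul c (toSeries μ f)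

theorem seriesMul_assoc {n : ℕ} (a b c : Series n) :
    seriesMul (seriesMul a b) c = seriesMul a (seriesMul b c) := by
  funext γ
  simp only [seriesMul, Finset.sum_mul, Finset.mul_sum]
  rw [Finset.sum_sigma', Finset.sum_sigma']
  refine Finset.sum_bij' (fun p _ => ⟨p.2, p.1 - p.2⟩) (fun p _ => ⟨p.1 + p.2, p.1⟩) ?_ ?_ ?_ ?_ ?_
  · rintro ⟨k, j⟩ h
    simp only [Finset.mem_sigma, Finset.mem_range, List.length_take, List.length_drop] at h ⊢
    omega
  · rintro ⟨j, i⟩ h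
    simp only [Finset.mem_sigma, Finset.mem_range, List.length_take, List.length_drop] at h ⊢
    omega
  · rintro ⟨k, j⟩ h
    simp only [Finset.mem_sigma, Finset.mem_range, List.length_take] at h
    have : j + (k - j) = k := by omega
    simp [this]
  · rintro ⟨j, i⟩ h
    simp
  · rintro ⟨k, j⟩ h
    simp only [Finset.mem_sigma, Finset.mem_range, List.length_take] at h
    have h1 : j + (k - j) = k := by omega
    have h2 : min j k = j := by omega
    simp only [List.take_take, List.drop_drop, List.drop_take, h1, h2, mul_assoc]

theorem seriesMul_const {n : ℕ} (z : ℂ) (c : Series n) :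
    seriesMul (fun α => if α = [] then z else 0) c = fun α => z * c α := by
  funext γ
  rw [seriesMul, Finset.sum_eq_single 0]
  · simp
  · intro k hk hk0
    have : γ.take k ≠ [] := by
      intro h
      rcases List.take_eq_nil_iff.1 h with h | h
      · exact hk0 h
      · subst h; simp at hk; exact hk0 hk
    simp [this]
  · simp

/-- The noncommutative Hardy algebra `F^∞(μ) = {U* L_φ U : φ a left multiplier of F²(μ)}`. -/
def hardyAlgebra {n : ℕ} (μ : Word n → ℝ) : Subalgebra ℂ (Fock n →L[ℂ] Fock n) where
  carrier := {A | ∃ c : Series n, HasFourierSeries μ A c}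
  mul_mem' := by
    rintro A B ⟨a, ha⟩ ⟨b, hb⟩
    refine ⟨seriesMul a b, fun f => ?_⟩
    rw [seriesMul_assoc, ← hb f, ← ha (B f)]
    rfl
  add_mem' := by
    rintro A B ⟨a, ha⟩ ⟨b, hb⟩
    refine ⟨a + b, fun f => ?_⟩
    have h1 := ha f
    have h2 := hb f
    funext γ
    have h3 := congrFun h1 γ
    have h4 := congrFun h2 γ
    simp only [toSeries, seriesMul, Pi.add_apply, add_mul, Finset.sum_add_distrib] at h3 h4 ⊢
    rw [← h3, ← h4]
    simp [add_div]
  algebraMap_mem' := by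
    intro z
    refine ⟨fun α => if α = [] then z else 0, fun f => ?_⟩
    rw [seriesMul_const]
    funext γ
    simp [toSeries, Algebra.algebraMap_eq_smul_one, mul_div_assoc]

/-! ### Completely bounded norm and the weak-star topology -/

section Operators

variable {H : Type*} [NormedAddCommGroup H] [InnerProductSpace ℂ H]

/-- The operator on the Hilbert space direct sum of `s` copies of `H` given by an `s × s` matrix of
operators on `H`. -/
def matrixOp {s : ℕ} (A : Matrix (Fin s) (Fin s) (H →L[ℂ] H)) :
    PiLp 2 (fun _ : Fin s => H) →L[ℂ] PiLp 2 (fun _ : Fin s => H) :=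
  (PiLp.continuousLinearEquiv 2 ℂ (fun _ : Fin s => H)).symm.toContinuousLinearMap ∘L
    ContinuousLinearMap.pi fun i => ∑ j, A i j ∘L PiLp.proj 2 (fun _ : Fin s => H) j

/-- The completely bounded norm `sup_s ‖Φ_s‖` of a linear map on an algebra of operators, where
`Φ_s` applies `Φ` to the entries of `s × s` matrices. It takes the value `∞` exactly when `Φ` is not
completely bounded. -/
def cbNorm {K : Type*} [NormedAddCommGroup K] [InnerProductSpace ℂ K]
    {S : Subalgebra ℂ (K →L[ℂ] K)} (Φ : S →ₗ[ℂ] (H →L[ℂ] H)) : ℝ≥0∞ :=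
  ⨆ (s : ℕ) (A : Matrix (Fin s) (Fin s) S)
    (_ : ‖matrixOp (A.map (fun a : S => (a : K →L[ℂ] K)))‖ ≤ 1), ‖matrixOp (A.map Φ)‖ₑ

variable (H) in
/-- The weak-star (ultraweak) topology of `B(H)`: the coarsest one making continuous all
functionals `A ↦ ∑ₖ ⟪yₖ, A xₖ⟫` with `∑ ‖xₖ‖² < ∞` and `∑ ‖yₖ‖² < ∞`. -/
def weakStarTopology : TopologicalSpace (H →L[ℂ] H) :=
  ⨅ (x : lp (fun _ : ℕ => H) 2) (y : lp (fun _ : ℕ => H) 2),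
    TopologicalSpace.induced (fun A : H →L[ℂ] H => ∑' k, ⟪y k, A (x k)⟫_ℂ) inferInstance

end Operators

end MultiShift

end

noncomputable section

namespace MultiShift

/-! ### Roots of submultiplicative sequences -/

/-! Let `a k` be the norm of the row operator `(T_α)_{|α| = k}`. It is submultiplicative, and the
joint spectral radius is the limit of its `k`-th roots. Choose weights for which `μ(α)` depends only
on the length: `μ(α) = w k` with `w k = (k + 1) max (a k, 1 / k!)`. The term `1 / k!` keeps `w`
positive when rows of `T` vanish; neither it nor the factor `k + 1` changes the limit of the roots.
Since `w` is submultiplicative, both multi-shifts are bounded. If there is at least one letter, the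
row norms of `W` are exactly `w k`, hence `r(W) = r(T)`.

The factor `k + 1` gives `∑ (a k / w k)² ≤ ∑ 1 / (k + 1)² = π² / 6`, so the Poisson kernel `K x = ∑
e_α ⊗ T_α* x / μ(α)` is bounded with norm at most `π / √6`; if `T` is nilpotent, only the first `m`
terms survive. The calculus is `Ψ(A) x = K* (A e_∅ ⊗ x)`, that is, `synthesis K` evaluated at `A
e_∅`.

Everything follows from this formula. It is bounded and linear in the single vector `A e_∅`, which
gives the continuity statements. The coordinates of `A e_∅` are `c_α μ(α)`, so `Ψ(A) x = ∑ c_α T_α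
x` unconditionally, and the Cesàro means converge. Multiplicativity is
`IsPoissonKernel.synthesis_apply_mul`. Since `M ⊗ I` has norm at most `‖M‖`, the cb-norm is at most
`‖K‖ = ‖K* K‖^{1/2}`, where `K* K = ∑ μ(α)⁻² T_α T_α*`. Gelfand's formula then compares the spectral
radii. -/

/-- The logarithms are subadditive, and the geometric lower bound keeps their averages bounded
below, so Fekete's lemma applies. The limit is an infimum, whence the last clause. -/
theorem tendsto_root_of_pow_le {a : ℕ → ℝ} (hmul : ∀ j k, a (j + k) ≤ a j * a k) {ε : ℝ}
    (hε : 0 < ε) (hle : ∀ k, ε ^ k ≤ a k) :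
    ∃ r : ℝ, 0 ≤ r ∧ Tendsto (fun k : ℕ => a k ^ (1 / (k : ℝ))) atTop (𝓝 r) ∧
      ∀ m : ℕ, m ≠ 0 → r ≤ a m ^ (1 / (m : ℝ)) := by
  have hpos : ∀ k, 0 < a k := fun k => (pow_pos hε k).trans_le (hle k)
  have hsub : Subadditive fun k => Real.log (a k) := fun j k => by
    rw [← Real.log_mul (hpos j).ne' (hpos k).ne']
    exact Real.log_le_log (hpos _) (hmul j k)
  have hbdd : BddBelow (Set.range fun k : ℕ => Real.log (a k) / k) := by
    refine ⟨min (Real.log ε) 0, ?_⟩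
    rintro _ ⟨k, rfl⟩
    rcases Nat.eq_zero_or_pos k with rfl | hk
    · simp
    · refine (min_le_left _ _).trans ?_
      have hk' : (0 : ℝ) < k := by exact_mod_cast hk
      rw [le_div_iff₀ hk', mul_comm, ← Real.log_pow]
      exact Real.log_le_log (pow_pos hε k) (hle k)
  have hexp : ∀ k : ℕ, a k ^ (1 / (k : ℝ)) = Real.exp (Real.log (a k) / k) := fun k => by
    rw [Real.rpow_def_of_pos (hpos k), mul_one_div]
  refine ⟨Real.exp hsub.lim, (Real.exp_pos _).le, ?_, fun m hm => ?_⟩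
  · simp only [hexp]
    exact (Real.continuous_exp.tendsto _).comp (hsub.tendsto_lim hbdd)
  · rw [hexp]
    exact Real.exp_le_exp.2 (hsub.lim_le_div hbdd hm)

theorem max_submultiplicative {a b : ℕ → ℝ} (ha : ∀ k, 0 ≤ a k) (hb : ∀ k, 0 ≤ b k)
    (hmul : ∀ j k, a (j + k) ≤ a j * a k) (hmul' : ∀ j k, b (j + k) ≤ b j * b k) (j k : ℕ) :
    max (a (j + k)) (b (j + k)) ≤ max (a j) (b j) * max (a k) (b k) :=
  max_le
    ((hmul j k).trans (mul_le_mul (le_max_left _ _) (le_max_left _ _) (ha k)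
      ((ha j).trans (le_max_left _ _))))
    ((hmul' j k).trans (mul_le_mul (le_max_right _ _) (le_max_right _ _) (hb k)
      ((ha j).trans (le_max_left _ _))))

/-- Fekete's lemma for nonnegative submultiplicative sequences. -/
theorem exists_tendsto_root {a : ℕ → ℝ} (h0 : ∀ k, 0 ≤ a k)
    (hmul : ∀ j k, a (j + k) ≤ a j * a k) :
    ∃ r : ℝ, 0 ≤ r ∧ Tendsto (fun k : ℕ => a k ^ (1 / (k : ℝ))) atTop (𝓝 r) := by
  by_cases h : ∃ ε : ℝ, 0 < ε ∧ ∀ k, ε ^ k ≤ a k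
  · obtain ⟨ε, hε, hle⟩ := h
    obtain ⟨r, hr, ht, -⟩ := tendsto_root_of_pow_le hmul hε hle
    exact ⟨r, hr, ht⟩
  push Not at h
  refine ⟨0, le_rfl, ?_⟩
  -- If the lower bound `ε ^ k` fails at `k = 0`, then `a 0 < 1` and `a 0 ≤ a 0 ^ 2` force `a 0 =
  -- 0`, hence `a 1 ≤ 0` and `m = 1` serves.
  have key : ∀ ε : ℝ, 0 < ε → ∃ m : ℕ, m ≠ 0 ∧ a m ≤ ε ^ m := by
    intro ε hε
    obtain ⟨m, hm⟩ := h ε hε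
    rcases Nat.eq_zero_or_pos m with rfl | hm0
    · have h00 : a 0 = 0 := by
        have h1 := hmul 0 0
        have h2 := h0 0
        simp only [pow_zero, add_zero] at hm h1
        nlinarith
      refine ⟨1, one_ne_zero, ?_⟩
      have h1 := hmul 0 1
      rw [h00, zero_mul, zero_add] at h1
      exact h1.trans (by positivity)
    · exact ⟨m, hm0.ne', hm.le⟩
  rw [Metric.tendsto_atTop']
  intro δ hδ
  have hε : 0 < δ / 2 := by positivity
  obtain ⟨m, hm0, hm⟩ := key _ hε
  -- The sequence `max (a k) ((δ / 2) ^ k)` has a geometric lower bound and dominates `a`; its limit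
  -- is at most its `m`-th root at `m`, which is `δ / 2`.
  obtain ⟨r, -, ht, hr⟩ := tendsto_root_of_pow_le
    (max_submultiplicative h0 (fun k => (pow_pos hε k).le) hmul
      fun j k => (pow_add (δ / 2) j k).le) hε fun k => le_max_right _ _
  have hrm := hr m hm0
  rw [max_eq_right hm, one_div, Real.pow_rpow_inv_natCast hε.le hm0] at hrm
  obtain ⟨N, hN⟩ := eventually_atTop.1 (ht.eventually_lt_const (show r < δ by linarith))
  refine ⟨N, fun k hk => ?_⟩
  rw [Real.dist_eq, sub_zero, abs_of_nonneg (Real.rpow_nonneg (h0 k) _)]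
  exact (Real.rpow_le_rpow (h0 k) (le_max_left _ _) (by positivity)).trans_lt (hN k hk.le)

theorem inv_factorial_submultiplicative (j k : ℕ) :
    (((j + k).factorial : ℝ))⁻¹ ≤ ((j.factorial : ℝ))⁻¹ * ((k.factorial : ℝ))⁻¹ := by
  rw [← mul_inv]
  refine inv_anti₀ (by positivity) ?_
  exact_mod_cast Nat.le_of_dvd (Nat.factorial_pos _) (Nat.factorial_mul_factorial_dvd_factorial_add j k)

theorem tendsto_root_inv_factorial :
    Tendsto (fun k : ℕ => ((k.factorial : ℝ))⁻¹ ^ (1 / (k : ℝ))) atTop (𝓝 0) := by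
  rw [Metric.tendsto_atTop']
  intro δ hδ
  have h1 := (FloorSemiring.tendsto_pow_div_factorial_atTop (2 / δ)).eventually_lt_const one_pos
  obtain ⟨N, hN⟩ := eventually_atTop.1 h1
  refine ⟨N, fun k hk => ?_⟩
  have hk0 : k ≠ 0 := by omega
  have h2 := hN k hk.le
  have hpos : (0 : ℝ) < (k.factorial : ℝ)⁻¹ := by positivity
  rw [Real.dist_eq, sub_zero, abs_of_nonneg (Real.rpow_nonneg hpos.le _)]
  have h3 : ((k.factorial : ℝ))⁻¹ ≤ (δ / 2) ^ k := by
    have h4 : (2 / δ) ^ k * (δ / 2) ^ k = 1 := by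
      rw [← mul_pow, div_mul_div_comm, mul_comm, div_self (by positivity), one_pow]
    have h5 : (0 : ℝ) < (δ / 2) ^ k := by positivity
    calc ((k.factorial : ℝ))⁻¹ = ((2 / δ) ^ k / k.factorial) * (δ / 2) ^ k := by
          rw [div_mul_eq_mul_div, h4, one_div]
      _ ≤ 1 * (δ / 2) ^ k := by gcongr
      _ = _ := one_mul _
  calc _ ≤ ((δ / 2) ^ k) ^ (1 / (k : ℝ)) := Real.rpow_le_rpow hpos.le h3 (by positivity)
    _ = δ / 2 := by rw [one_div, Real.pow_rpow_inv_natCast (by positivity) hk0]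
    _ < δ := by linarith

/-- The sequence `(k + 1) max (a_k, 1 / k!)`, a strictly positive modification of `(k + 1) a_k`. -/
def regularization (a : ℕ → ℝ) (k : ℕ) : ℝ := (k + 1) * max (a k) ((k.factorial : ℝ))⁻¹

theorem regularization_pos (a : ℕ → ℝ) (k : ℕ) : 0 < regularization a k :=
  mul_pos (by positivity) (lt_of_lt_of_le (by positivity) (le_max_right _ _))

theorem regularization_zero {a : ℕ → ℝ} (h : a 0 ≤ 1) : regularization a 0 = 1 := by
  simp [regularization, h]

theorem le_regularization (a : ℕ → ℝ) (k : ℕ) : (k + 1) * a k ≤ regularization a k :=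
  mul_le_mul_of_nonneg_left (le_max_left _ _) (by positivity)

theorem regularization_submultiplicative {a : ℕ → ℝ} (h0 : ∀ k, 0 ≤ a k)
    (hmul : ∀ j k, a (j + k) ≤ a j * a k) (j k : ℕ) :
    regularization a (j + k) ≤ regularization a j * regularization a k := by
  unfold regularization
  rw [mul_mul_mul_comm]
  refine mul_le_mul ?_ ?_ ((h0 _).trans (le_max_left _ _))
    (by positivity)
  · push_cast
    nlinarith [mul_nonneg (Nat.cast_nonneg (α := ℝ) j) (Nat.cast_nonneg (α := ℝ) k)]
  · exact max_submultiplicative (b := fun k => ((k.factorial : ℝ))⁻¹) h0 (fun k => by positivity) hmul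
      inv_factorial_submultiplicative j k

theorem tendsto_root_regularization {a : ℕ → ℝ} (h0 : ∀ k, 0 ≤ a k) {r : ℝ} (hr : 0 ≤ r)
    (ht : Tendsto (fun k : ℕ => a k ^ (1 / (k : ℝ))) atTop (𝓝 r)) :
    Tendsto (fun k : ℕ => regularization a k ^ (1 / (k : ℝ))) atTop (𝓝 r) := by
  have h1 : Tendsto (fun k : ℕ => ((k : ℝ) + 1) ^ (1 / (k : ℝ))) atTop (𝓝 1) := by
    -- The limit of `x ^ (1 / (1 * x - 1))`, taken along `x = k + 1`.
    have h := (tendsto_rpow_div_mul_add 1 1 (-1) (by norm_num)).comp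
      (tendsto_atTop_add_const_right atTop (1 : ℝ) (tendsto_natCast_atTop_atTop (R := ℝ)))
    refine h.congr fun k => ?_
    simp
  have h2 := h1.mul (ht.max tendsto_root_inv_factorial)
  rw [max_eq_left hr, one_mul] at h2
  refine h2.congr fun k => ?_
  have hk : (0 : ℝ) ≤ 1 / (k : ℝ) := by positivity
  have hf : (0 : ℝ) ≤ ((k.factorial : ℝ))⁻¹ := by positivity
  rw [regularization, Real.mul_rpow (by positivity) ((h0 k).trans (le_max_left _ _))]
  congr 1
  rcases le_total (a k) ((k.factorial : ℝ))⁻¹ with h | h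
  · rw [max_eq_right h, max_eq_right (Real.rpow_le_rpow (h0 k) h hk)]
  · rw [max_eq_left h, max_eq_left (Real.rpow_le_rpow hf h hk)]

/-! ### Sums over words and row norms -/

theorem sum_wordsOfLength_add {M : Type*} [AddCommMonoid M] {n : ℕ} (j k : ℕ) (f : Word n → M) :
    ∑ γ ∈ wordsOfLength n (j + k), f γ =
      ∑ α ∈ wordsOfLength n j, ∑ β ∈ wordsOfLength n k, f (α ++ β) := by
  rw [← Finset.sum_product']
  refine Finset.sum_bij' (fun γ _ => (γ.take j, γ.drop j)) (fun p _ => p.1 ++ p.2) ?_ ?_ ?_ ?_ ?_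
  · intro γ h
    rw [mem_wordsOfLength] at h
    simp only [Finset.mem_product, mem_wordsOfLength, List.length_take, List.length_drop]
    omega
  · rintro ⟨α, β⟩ h
    simp only [Finset.mem_product, mem_wordsOfLength] at h
    simp [mem_wordsOfLength, h.1, h.2]
  · intro γ _
    simp
  · rintro ⟨α, β⟩ h
    simp only [Finset.mem_product, mem_wordsOfLength] at h
    simp [← h.1]
  · intro γ _
    simp

section Operators

variable {H : Type*} [NormedAddCommGroup H] [InnerProductSpace ℂ H]

theorem wordOp_nil {n : ℕ} (T : Fin n → H →L[ℂ] H) : wordOp T [] = 1 := rfl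

theorem wordOp_cons {n : ℕ} (T : Fin n → H →L[ℂ] H) (i : Fin n) (α : Word n) :
    wordOp T (i :: α) = T i * wordOp T α := rfl

theorem wordOp_append {n : ℕ} (T : Fin n → H →L[ℂ] H) (α β : Word n) :
    wordOp T (α ++ β) = wordOp T α * wordOp T β := by simp [wordOp]

variable [CompleteSpace H]

open ContinuousLinearMap (adjoint)

theorem inner_sum_mul_adjoint {ι : Type*} (s : Finset ι) (A : ι → H →L[ℂ] H) (x y : H) :
    ⟪(∑ i ∈ s, A i * adjoint (A i)) x, y⟫_ℂ = ∑ i ∈ s, ⟪adjoint (A i) x, adjoint (A i) y⟫_ℂ := by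
  simp only [sum_apply, sum_inner, mul_apply_eq_comp,
    ContinuousLinearMap.adjoint_inner_right]

theorem sum_norm_sq_adjoint_le {ι : Type*} (s : Finset ι) (A : ι → H →L[ℂ] H) (x : H) :
    ∑ i ∈ s, ‖adjoint (A i) x‖ ^ 2 ≤ ‖∑ i ∈ s, A i * adjoint (A i)‖ * ‖x‖ ^ 2 := by
  have h := inner_sum_mul_adjoint s A x x
  simp only [inner_self_eq_norm_sq_to_K] at h
  have h2 : ‖∑ i ∈ s, ((‖adjoint (A i) x‖ : ℂ)) ^ 2‖ = ∑ i ∈ s, ‖adjoint (A i) x‖ ^ 2 := by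
    have : (∑ i ∈ s, ((‖adjoint (A i) x‖ : ℂ)) ^ 2) =
        ((∑ i ∈ s, ‖adjoint (A i) x‖ ^ 2 : ℝ) : ℂ) := by push_cast; rfl
    rw [this, Complex.norm_real, Real.norm_of_nonneg (by positivity)]
  refine h2.symm.le.trans ?_
  have h3 := norm_inner_le_norm (𝕜 := ℂ) ((∑ i ∈ s, A i * adjoint (A i)) x) x
  rw [h] at h3
  refine h3.trans ?_
  rw [sq, ← mul_assoc]
  gcongr
  exact ContinuousLinearMap.le_opNorm _ _

/-- Converse of `sum_norm_sq_adjoint_le`. Together they replace `‖∑ A A*‖` by the best constant in a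
quadratic inequality, the only form in which row norms are estimated below. -/
theorem norm_sum_mul_adjoint_le {ι : Type*} (s : Finset ι) (A : ι → H →L[ℂ] H) {c : ℝ} (hc : 0 ≤ c)
    (h : ∀ x, ∑ i ∈ s, ‖adjoint (A i) x‖ ^ 2 ≤ c * ‖x‖ ^ 2) :
    ‖∑ i ∈ s, A i * adjoint (A i)‖ ≤ c := by
  refine ContinuousLinearMap.opNorm_le_of_re_inner_le hc fun x y hx hy => ?_
  rw [inner_sum_mul_adjoint, map_sum]
  calc ∑ i ∈ s, RCLike.re ⟪adjoint (A i) x, adjoint (A i) y⟫_ℂ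
      ≤ ∑ i ∈ s, (‖adjoint (A i) x‖ ^ 2 + ‖adjoint (A i) y‖ ^ 2) / 2 := by
        refine Finset.sum_le_sum fun i _ => ?_
        have h1 := re_inner_le_norm (𝕜 := ℂ) (adjoint (A i) x) (adjoint (A i) y)
        nlinarith [sq_nonneg (‖adjoint (A i) x‖ - ‖adjoint (A i) y‖)]
    _ ≤ c := by
        rw [← Finset.sum_div, Finset.sum_add_distrib]
        have h1 := h x
        have h2 := h y
        rw [hx] at h1
        rw [hy] at h2
        linarith

/-- The norm of the row operator with entries `T_α`, `|α| = k`. -/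
def rowNorm {n : ℕ} (T : Fin n → H →L[ℂ] H) (k : ℕ) : ℝ :=
  √‖∑ α ∈ wordsOfLength n k, wordOp T α * adjoint (wordOp T α)‖

theorem rowNorm_nonneg {n : ℕ} (T : Fin n → H →L[ℂ] H) (k : ℕ) : 0 ≤ rowNorm T k :=
  Real.sqrt_nonneg _

theorem rowNorm_sq {n : ℕ} (T : Fin n → H →L[ℂ] H) (k : ℕ) :
    rowNorm T k ^ 2 = ‖∑ α ∈ wordsOfLength n k, wordOp T α * adjoint (wordOp T α)‖ :=
  Real.sq_sqrt (norm_nonneg _)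

theorem sum_norm_sq_adjoint_wordOp_le {n : ℕ} (T : Fin n → H →L[ℂ] H) (k : ℕ) (x : H) :
    ∑ α ∈ wordsOfLength n k, ‖adjoint (wordOp T α) x‖ ^ 2 ≤ rowNorm T k ^ 2 * ‖x‖ ^ 2 := by
  rw [rowNorm_sq]
  exact sum_norm_sq_adjoint_le _ _ x

theorem rowNorm_le {n : ℕ} (T : Fin n → H →L[ℂ] H) (k : ℕ) {c : ℝ} (hc : 0 ≤ c)
    (h : ∀ x, ∑ α ∈ wordsOfLength n k, ‖adjoint (wordOp T α) x‖ ^ 2 ≤ c ^ 2 * ‖x‖ ^ 2) :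
    rowNorm T k ≤ c :=
  Real.sqrt_le_iff.2 ⟨hc, norm_sum_mul_adjoint_le _ _ (sq_nonneg c) h⟩

theorem rowNorm_zero_le_one {n : ℕ} (T : Fin n → H →L[ℂ] H) : rowNorm T 0 ≤ 1 := by
  refine rowNorm_le T 0 zero_le_one fun x => ?_
  have : wordsOfLength n 0 = {[]} := by
    ext α
    simp [mem_wordsOfLength]
  simp [this, wordOp_nil, ← ContinuousLinearMap.star_eq_adjoint]

/-- Since `T_{αβ}* = T_β* T_α*`, sum over `β` first at the vector `T_α* x`, then over `α`. -/
theorem rowNorm_submultiplicative {n : ℕ} (T : Fin n → H →L[ℂ] H) (j k : ℕ) :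
    rowNorm T (j + k) ≤ rowNorm T j * rowNorm T k := by
  refine rowNorm_le T _ (mul_nonneg (rowNorm_nonneg _ _) (rowNorm_nonneg _ _)) fun x => ?_
  rw [sum_wordsOfLength_add]
  calc ∑ α ∈ wordsOfLength n j, ∑ β ∈ wordsOfLength n k, ‖adjoint (wordOp T (α ++ β)) x‖ ^ 2
      = ∑ α ∈ wordsOfLength n j, ∑ β ∈ wordsOfLength n k,
          ‖adjoint (wordOp T β) (adjoint (wordOp T α) x)‖ ^ 2 := by
        refine Finset.sum_congr rfl fun α _ => Finset.sum_congr rfl fun β _ => ?_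
        rw [wordOp_append, ContinuousLinearMap.mul_def, ContinuousLinearMap.adjoint_comp]
        rfl
    _ ≤ ∑ α ∈ wordsOfLength n j, rowNorm T k ^ 2 * ‖adjoint (wordOp T α) x‖ ^ 2 :=
        Finset.sum_le_sum fun α _ => sum_norm_sq_adjoint_wordOp_le T k _
    _ ≤ rowNorm T k ^ 2 * (rowNorm T j ^ 2 * ‖x‖ ^ 2) := by
        rw [← Finset.mul_sum]
        gcongr
        exact sum_norm_sq_adjoint_wordOp_le T j x
    _ = (rowNorm T j * rowNorm T k) ^ 2 * ‖x‖ ^ 2 := by ring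

theorem hasJointSpectralRadius_iff {n : ℕ} (T : Fin n → H →L[ℂ] H) (r : ℝ) :
    HasJointSpectralRadius T r ↔
      Tendsto (fun k : ℕ => rowNorm T k ^ (1 / (k : ℝ))) atTop (𝓝 r) := by
  unfold HasJointSpectralRadius
  refine tendsto_congr fun k => ?_
  rw [← rowNorm_sq, ← Real.rpow_natCast, ← Real.rpow_mul (rowNorm_nonneg T k)]
  congr 1
  rcases eq_or_ne (k : ℝ) 0 with h | h
  · simp [h]
  · field_simp
    norm_num

theorem exists_hasJointSpectralRadius {n : ℕ} (T : Fin n → H →L[ℂ] H) :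
    ∃ r : ℝ, 0 ≤ r ∧ HasJointSpectralRadius T r := by
  simp only [hasJointSpectralRadius_iff]
  exact exists_tendsto_root (rowNorm_nonneg T) (rowNorm_submultiplicative T)

end Operators

/-! ### Square summable families -/

section SquareSummable

variable {ι : Type*} {E : ι → Type*} [∀ i, NormedAddCommGroup (E i)]

theorem memℓp_two_of_sum_sq_le {f : ∀ i, E i} {C : ℝ}
    (h : ∀ s : Finset ι, ∑ i ∈ s, ‖f i‖ ^ 2 ≤ C) : Memℓp f 2 :=
  memℓp_gen' (C := C) fun s => by simpa using h s

theorem norm_le_of_sum_sq_le {f : lp E 2} {C : ℝ} (hC : 0 ≤ C)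
    (h : ∀ s : Finset ι, ∑ i ∈ s, ‖f i‖ ^ 2 ≤ C ^ 2) : ‖f‖ ≤ C :=
  lp.norm_le_of_forall_sum_le (by simp) hC fun s => by simpa using h s

theorem sum_sq_le_norm_sq (f : lp E 2) (s : Finset ι) : ∑ i ∈ s, ‖f i‖ ^ 2 ≤ ‖f‖ ^ 2 := by
  simpa using lp.sum_rpow_le_norm_rpow (p := 2) (by simp) f s

theorem hasSum_norm_sq (f : lp E 2) : HasSum (fun i => ‖f i‖ ^ 2) (‖f‖ ^ 2) := by
  simpa using lp.hasSum_norm (p := 2) (by simp) f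

end SquareSummable

/-- Composition with an injective map followed by multiplication with a bounded family. -/
def weightedPullback {ι ι' : Type*} (e : ι → ι') (he : Function.Injective e) (m : ι → ℂ) (C : ℝ)
    (hC : 0 ≤ C) (hm : ∀ i, ‖m i‖ ≤ C) : lp (fun _ : ι' => ℂ) 2 →L[ℂ] lp (fun _ : ι => ℂ) 2 :=
  have key : ∀ (f : lp (fun _ : ι' => ℂ) 2) (s : Finset ι),
      ∑ i ∈ s, ‖m i * f (e i)‖ ^ 2 ≤ (C * ‖f‖) ^ 2 := fun f s => by
    calc ∑ i ∈ s, ‖m i * f (e i)‖ ^ 2 ≤ ∑ i ∈ s, C ^ 2 * ‖f (e i)‖ ^ 2 := by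
          refine Finset.sum_le_sum fun i _ => ?_
          rw [norm_mul, mul_pow]
          gcongr
          exact hm i
      _ = C ^ 2 * ∑ j ∈ s.map ⟨e, he⟩, ‖f j‖ ^ 2 := by
          rw [Finset.sum_map, Finset.mul_sum]
          rfl
      _ ≤ (C * ‖f‖) ^ 2 := by
          rw [mul_pow]
          gcongr
          exact sum_sq_le_norm_sq f _
  LinearMap.mkContinuous
    { toFun := fun f => ⟨fun i => m i * f (e i), memℓp_two_of_sum_sq_le (key f)⟩
      map_add' := fun f g => by
        ext i
        exact mul_add _ _ _
      map_smul' := fun c f => by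
        ext i
        exact mul_left_comm _ _ _ } C fun f =>
    norm_le_of_sum_sq_le (mul_nonneg hC (norm_nonneg f)) (key f)

theorem weightedPullback_apply {ι ι' : Type*} (e : ι → ι') (he : Function.Injective e) (m : ι → ℂ)
    (C : ℝ) (hC : 0 ≤ C) (hm : ∀ i, ‖m i‖ ≤ C) (f : lp (fun _ : ι' => ℂ) 2) (i : ι) :
    weightedPullback e he m C hC hm f i = m i * f (e i) := rfl

/-! ### Weighted left multi-shifts -/

section Shift

variable {n : ℕ}

theorem basisVec_apply (α β : Word n) : basisVec α β = if β = α then 1 else 0 := by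
  rw [basisVec, lp.single_apply]
  by_cases h : β = α
  · subst h; simp
  · simp [h]

theorem inner_basisVec_left (α : Word n) (f : Fock n) : ⟪basisVec α, f⟫_ℂ = f α := by
  rw [basisVec, lp.inner_single_left]
  simp

theorem norm_basisVec (α : Word n) : ‖basisVec α‖ = 1 := by
  rw [basisVec, lp.norm_single (by simp)]
  simp

theorem hasSum_basisVec (f : Fock n) : HasSum (fun α => f α • basisVec α) f := by
  have h := lp.hasSum_single (p := 2) (by simp) f
  refine h.congr_fun fun α => ?_
  rw [basisVec, ← lp.single_smul, smul_eq_mul, mul_one]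

theorem clm_ext_basisVec {F : Type*} [NormedAddCommGroup F] [NormedSpace ℂ F]
    {A B : Fock n →L[ℂ] F} (h : ∀ α, A (basisVec α) = B (basisVec α)) : A = B := by
  ext f
  have hA := (hasSum_basisVec f).mapL A
  have hB := (hasSum_basisVec f).mapL B
  simp only [map_smul, h] at hA hB
  exact hA.unique hB

theorem weightProd_pos {μ : Word n → ℝ} (hμ : ∀ β, 0 < μ β) : ∀ α, 0 < weightProd μ α
  | [] => one_pos
  | _ :: β => mul_pos (hμ _) (weightProd_pos hμ β)

theorem exists_isWeightedLeftMultiShift {μ : Word n → ℝ} (hμ : IsAdmissibleWeight μ) :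
    ∃ W : Fin n → Fock n →L[ℂ] Fock n, IsWeightedLeftMultiShift μ W := by
  have hC : ∀ i, ∃ C, 0 ≤ C ∧ ∀ α : Word n, ‖((μ (i :: α) : ℝ) : ℂ)‖ ≤ C := fun i => by
    obtain ⟨C, hC⟩ := hμ.left_bounded i
    have h : ∀ α, μ (i :: α) ≤ C := fun α => hC ⟨α, rfl⟩
    refine ⟨C, (hμ.pos _).le.trans (h []), fun α => ?_⟩
    rw [Complex.norm_real, Real.norm_of_nonneg (hμ.pos _).le]
    exact h α
  choose C hC0 hC using hC
  -- The adjoint of the shift has the explicit coordinates `α ↦ μ(iα) f(iα)`, so it is easier to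
  -- bound; `W_i` is then obtained as its adjoint.
  refine ⟨fun i => ContinuousLinearMap.adjoint (weightedPullback (fun α => i :: α)
    (List.cons_injective) (fun α => ((μ (i :: α) : ℝ) : ℂ)) (C i) (hC0 i) (hC i)), fun i α => ?_⟩
  ext γ
  rw [← inner_basisVec_left γ, ContinuousLinearMap.adjoint_inner_right, ← inner_conj_symm,
    inner_basisVec_left, weightedPullback_apply, basisVec_apply, lp.coeFn_smul, Pi.smul_apply,
    basisVec_apply]
  by_cases h : γ = i :: α
  · simp [h]
  · simp [h, Ne.symm h]

variable {μ : Word n → ℝ} {W : Fin n → Fock n →L[ℂ] Fock n}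

theorem IsWeightedLeftMultiShift.wordOp_basisVec (hW : IsWeightedLeftMultiShift μ W)
    (hμ : ∀ β, 0 < μ β) (α β : Word n) :
    wordOp W α (basisVec β) =
      ((weightProd μ (α ++ β) / weightProd μ β : ℝ) : ℂ) • basisVec (α ++ β) := by
  have h0 := (weightProd_pos hμ β).ne'
  induction α with
  | nil => simp [wordOp_nil, h0]
  | cons i α ih =>
    rw [wordOp_cons, mul_apply_eq_comp, ih, map_smul, hW, smul_smul, ← Complex.ofReal_mul]
    simp only [List.cons_append, weightProd]
    ring_nf

theorem IsWeightedLeftMultiShift.adjoint_wordOp_apply (hW : IsWeightedLeftMultiShift μ W)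
    (hμ : ∀ β, 0 < μ β) (α β : Word n) (f : Fock n) :
    ContinuousLinearMap.adjoint (wordOp W α) f β =
      ((weightProd μ (α ++ β) / weightProd μ β : ℝ) : ℂ) * f (α ++ β) := by
  rw [← inner_basisVec_left β, ContinuousLinearMap.adjoint_inner_right, hW.wordOp_basisVec hμ,
    inner_smul_left, inner_basisVec_left, Complex.conj_ofReal]

theorem IsWeightedLeftMultiShift.hasFourierSeries (hW : IsWeightedLeftMultiShift μ W)
    (hμ : ∀ β, 0 < μ β) (i : Fin n) :
    HasFourierSeries μ (W i) (fun α => if α = [i] then 1 else 0) := by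
  intro f
  funext γ
  have key : ∀ γ : Word n, lp.evalCLM ℂ (fun _ : Word n => ℂ) 2 γ ∘L W i =
      if γ.head? = some i then
        (μ γ : ℂ) • lp.evalCLM ℂ (fun _ : Word n => ℂ) 2 γ.tail else 0 := fun γ => by
    refine clm_ext_basisVec fun α => ?_
    have h1 : (lp.evalCLM ℂ (fun _ : Word n => ℂ) 2 γ ∘L W i) (basisVec α) =
        W i (basisVec α) γ := rfl
    rw [h1, hW, lp.coeFn_smul, Pi.smul_apply, basisVec_apply]
    cases γ with
    | nil => simp
    | cons j β =>
      by_cases hj : j = i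
      · subst hj
        have h2 : (lp.evalCLM ℂ (fun _ : Word n => ℂ) 2 β) (basisVec α) = basisVec α β := rfl
        rw [if_pos (show (j :: β).head? = some j from rfl), _root_.smul_apply, List.tail_cons, h2, basisVec_apply]
        by_cases hβ : β = α <;> simp [hβ]
      · simp [hj]
  have h := congrArg (fun A => A f) (key γ)
  have h1 : (lp.evalCLM ℂ (fun _ : Word n => ℂ) 2 γ ∘L W i) f = W i f γ := rfl
  simp only [h1] at h
  rw [toSeries, h, seriesMul]
  cases γ with
  | nil => simp
  | cons j β =>
    rw [Finset.sum_eq_single 1]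
    · by_cases hj : j = i
      · subst hj
        have h2 : (lp.evalCLM ℂ (fun _ : Word n => ℂ) 2 β) f = f β := rfl
        have h3 : (μ (j :: β) : ℂ) ≠ 0 := by exact_mod_cast (hμ _).ne'
        simp [h2, toSeries, weightProd, mul_div_mul_left, h3]
      · simp [hj]
    · intro k hk hk1
      rcases k with _ | _ | k
      · simp
      · exact absurd rfl hk1
      · rcases β with _ | ⟨j', β⟩
        · simp at hk
        · simp
    · simp

end Shift

/-! ### Weights depending only on the length -/

/-- The weights for which `weightProd` at a word of length `k` is `w k`. -/
def lengthWeight (n : ℕ) (w : ℕ → ℝ) : Word n → ℝ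
  | [] => 1
  | _ :: β => w (β.length + 1) / w β.length

section LengthWeight

variable {n : ℕ} {w : ℕ → ℝ}

theorem lengthWeight_pos (hpos : ∀ k, 0 < w k) : ∀ α, 0 < lengthWeight n w α
  | [] => one_pos
  | _ :: _ => div_pos (hpos _) (hpos _)

theorem weightProd_lengthWeight (h0 : w 0 = 1) (hpos : ∀ k, 0 < w k) (α : Word n) :
    weightProd (lengthWeight n w) α = w α.length := by
  induction α with
  | nil => simp [weightProd, h0]
  | cons _ β ih =>
    rw [weightProd, ih, lengthWeight, div_mul_cancel₀ _ (hpos _).ne', List.length_cons]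

theorem isAdmissibleWeight_lengthWeight (h0 : w 0 = 1) (hpos : ∀ k, 0 < w k)
    (hmul : ∀ j k, w (j + k) ≤ w j * w k) : IsAdmissibleWeight (lengthWeight n w) := by
  have hratio : ∀ k, w (k + 1) / w k ≤ w 1 := fun k => by
    rw [div_le_iff₀ (hpos k), mul_comm]
    exact hmul k 1
  refine ⟨lengthWeight_pos hpos, rfl, fun i => ⟨w 1, ?_⟩, fun i => ⟨w 1, ?_⟩⟩
  · rintro _ ⟨α, rfl⟩
    exact hratio _
  · rintro _ ⟨α, rfl⟩
    simp only [weightProd_lengthWeight h0 hpos, List.length_append, List.length_singleton]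
    exact hratio _

/-- Each coordinate `f(αβ)` with `|α| = k` arises from exactly one pair `(α, β)`, and its
coefficient `w(k + |β|) / w(|β|)` is at most `w k`. -/
theorem rowNorm_weightedLeftMultiShift_le (h0 : w 0 = 1) (hpos : ∀ k, 0 < w k)
    (hmul : ∀ j k, w (j + k) ≤ w j * w k) {W : Fin n → Fock n →L[ℂ] Fock n}
    (hW : IsWeightedLeftMultiShift (lengthWeight n w) W) (k : ℕ) : rowNorm W k ≤ w k := by
  refine rowNorm_le W k (hpos k).le fun f => ?_
  have hle : ∀ α ∈ wordsOfLength n k, ∀ s : Finset (Word n),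
      ∑ β ∈ s, ‖ContinuousLinearMap.adjoint (wordOp W α) f β‖ ^ 2 ≤
        w k ^ 2 * ∑ β ∈ s, ‖f (α ++ β)‖ ^ 2 := fun α hα s => by
    rw [mem_wordsOfLength] at hα
    rw [Finset.mul_sum]
    refine Finset.sum_le_sum fun β _ => ?_
    rw [hW.adjoint_wordOp_apply (lengthWeight_pos hpos), norm_mul, mul_pow,
      weightProd_lengthWeight h0 hpos, weightProd_lengthWeight h0 hpos, Complex.norm_real,
      Real.norm_of_nonneg (div_pos (hpos _) (hpos _)).le, List.length_append, hα]
    have h1 := hpos (k + β.length)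
    have h2 := hpos β.length
    gcongr
    rw [div_le_iff₀ h2]
    exact hmul _ _
  have hsum : ∀ s : Finset (Word n), ∑ β ∈ s, ∑ α ∈ wordsOfLength n k,
      ‖ContinuousLinearMap.adjoint (wordOp W α) f β‖ ^ 2 ≤ w k ^ 2 * ‖f‖ ^ 2 := fun s => by
    rw [Finset.sum_comm]
    refine (Finset.sum_le_sum fun α hα => hle α hα s).trans ?_
    rw [← Finset.mul_sum, ← Finset.sum_product']
    have hinj : Set.InjOn (fun p : Word n × Word n => p.1 ++ p.2)
        (wordsOfLength n k ×ˢ s : Finset (Word n × Word n)) := by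
      rintro ⟨α, β⟩ hp ⟨α', β'⟩ hp' h
      simp only [Finset.coe_product, Set.mem_prod, Finset.mem_coe, mem_wordsOfLength] at hp hp'
      obtain ⟨h1, h2⟩ := List.append_inj h (hp.1.trans hp'.1.symm)
      exact Prod.ext h1 h2
    have := Finset.sum_image (f := fun γ => ‖f γ‖ ^ 2) hinj
    rw [← this]
    gcongr
    exact sum_sq_le_norm_sq f _
  have hs := hasSum_sum fun α (_ : α ∈ wordsOfLength n k) =>
    hasSum_norm_sq (ContinuousLinearMap.adjoint (wordOp W α) f)
  exact hasSum_le_of_sum_le hs hsum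

/-- Test on `e_α` with `|α| = k`: the coordinate of `W_α* e_α` at the empty word is `w k`. A word of
length `k` exists because there is a letter. -/
theorem le_rowNorm_weightedLeftMultiShift (hn : n ≠ 0) (h0 : w 0 = 1) (hpos : ∀ k, 0 < w k)
    {W : Fin n → Fock n →L[ℂ] Fock n}
    (hW : IsWeightedLeftMultiShift (lengthWeight n w) W) (k : ℕ) : w k ≤ rowNorm W k := by
  let α : Word n := List.replicate k ⟨0, Nat.pos_of_ne_zero hn⟩
  have hα : α.length = k := List.length_replicate
  have h1 : w k ≤ ‖ContinuousLinearMap.adjoint (wordOp W α) (basisVec α)‖ := by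
    have h := lp.norm_apply_le_norm (p := 2) (by simp)
      (ContinuousLinearMap.adjoint (wordOp W α) (basisVec α)) []
    rwa [hW.adjoint_wordOp_apply (lengthWeight_pos hpos), weightProd_lengthWeight h0 hpos,
      weightProd_lengthWeight h0 hpos, List.append_nil, hα, basisVec_apply, if_pos rfl, mul_one,
      List.length_nil, h0, div_one, Complex.norm_real, Real.norm_of_nonneg (hpos k).le] at h
  have h2 := sum_norm_sq_adjoint_wordOp_le W k (basisVec α)
  rw [norm_basisVec, one_pow, mul_one] at h2
  have h3 := Finset.single_le_sum (f := fun β =>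
    ‖ContinuousLinearMap.adjoint (wordOp W β) (basisVec α)‖ ^ 2) (fun _ _ => by positivity)
    (mem_wordsOfLength.2 hα)
  exact h1.trans (le_of_sq_le_sq (h3.trans h2) (rowNorm_nonneg W k))

end LengthWeight

theorem hasJointSpectralRadius_of_no_letters {H : Type*} [NormedAddCommGroup H]
    [InnerProductSpace ℂ H] [CompleteSpace H] (T : Fin 0 → H →L[ℂ] H) :
    HasJointSpectralRadius T 0 := by
  rw [hasJointSpectralRadius_iff]
  refine tendsto_const_nhds.congr' ?_
  filter_upwards [eventually_gt_atTop 0] with k hk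
  have h : wordsOfLength 0 k = ∅ := by
    refine Finset.eq_empty_of_forall_notMem fun α hα => ?_
    rw [mem_wordsOfLength] at hα
    rcases α with _ | ⟨i, _⟩
    · simp at hα; omega
    · exact i.elim0
  have hk' : (k : ℝ)⁻¹ ≠ 0 := by positivity
  simp [rowNorm, h, Real.zero_rpow hk']

/-! ### Elementary tensors and matrices of operators -/

section Tensor

variable {ι : Type*} {H : Type*} [NormedAddCommGroup H] [InnerProductSpace ℂ H]

/-- The elementary tensor `f ⊗ x`, as a square summable family of vectors. -/
def tensor (ι H : Type*) [NormedAddCommGroup H] [InnerProductSpace ℂ H] :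
    lp (fun _ : ι => ℂ) 2 →L[ℂ] H →L[ℂ] lp (fun _ : ι => H) 2 :=
  have key : ∀ (f : lp (fun _ : ι => ℂ) 2) (x : H) (s : Finset ι),
      ∑ i ∈ s, ‖f i • x‖ ^ 2 ≤ (‖f‖ * ‖x‖) ^ 2 := fun f x s => by
    simp only [norm_smul, mul_pow, ← Finset.sum_mul]
    gcongr
    exact sum_sq_le_norm_sq f s
  LinearMap.mkContinuous₂
    (LinearMap.mk₂ ℂ (fun f x => ⟨fun i => f i • x, memℓp_two_of_sum_sq_le (key f x)⟩)
      (fun f g x => by ext i; exact add_smul _ _ _)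
      (fun c f x => by ext i; exact mul_smul _ _ _)
      (fun f x y => by ext i; exact smul_add _ _ _)
      (fun c f x => by ext i; exact smul_comm _ _ _)) 1 fun f x => by
    rw [one_mul]
    exact norm_le_of_sum_sq_le (by positivity) (key f x)

theorem tensor_apply (f : lp (fun _ : ι => ℂ) 2) (x : H) (i : ι) :
    tensor ι H f x i = f i • x := rfl

theorem norm_sq_sum_tensor {κ : Type*} [Fintype κ] (f : κ → lp (fun _ : ι => ℂ) 2) {u : κ → H}
    (hu : Orthonormal ℂ u) : ‖∑ l, tensor ι H (f l) (u l)‖ ^ 2 = ∑ l, ‖f l‖ ^ 2 := by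
  have h1 := hasSum_norm_sq (∑ l, tensor ι H (f l) (u l))
  have h2 := hasSum_sum fun l (_ : l ∈ Finset.univ) => hasSum_norm_sq (f l)
  refine h1.unique (h2.congr_fun fun i => ?_)
  have h3 : (∑ l, tensor ι H (f l) (u l) : lp (fun _ : ι => H) 2) i = ∑ l, f l i • u l := by
    rw [lp.coeFn_sum, Finset.sum_apply]
    rfl
  have h4 := hu.inner_sum (fun l => f l i) (fun l => f l i) Finset.univ
  rw [h3, ← Complex.ofReal_inj]
  push_cast
  rw [inner_self_eq_norm_sq_to_K] at h4
  refine h4.trans (Finset.sum_congr rfl fun l _ => ?_)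
  rw [← Complex.normSq_eq_conj_mul_self, Complex.normSq_eq_norm_sq]
  push_cast
  rfl

theorem matrixOp_apply {s : ℕ} (A : Matrix (Fin s) (Fin s) (H →L[ℂ] H))
    (x : PiLp 2 (fun _ : Fin s => H)) (i : Fin s) : matrixOp A x i = ∑ j, A i j (x j) := by
  simp [matrixOp]

/-- The ampliation of a matrix of operators on `ℓ²` by the identity of `H` does not increase the
norm, tested on column vectors of elementary tensors. -/
theorem sum_norm_sq_tensor_le {s : ℕ}
    (M : Matrix (Fin s) (Fin s) (lp (fun _ : ι => ℂ) 2 →L[ℂ] lp (fun _ : ι => ℂ) 2))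
    (e : lp (fun _ : ι => ℂ) 2) (x : Fin s → H) :
    ∑ i, ‖∑ j, tensor ι H (M i j e) (x j)‖ ^ 2 ≤
      ‖matrixOp M‖ ^ 2 * (‖e‖ ^ 2 * ∑ j, ‖x j‖ ^ 2) := by
  -- Expanding the `x j` in an orthonormal basis of their span makes `M ⊗ I` act separately on each
  -- coordinate column `(a l j • e)_j`; the columns are recombined by Pythagoras.
  let V := Submodule.span ℂ (Set.range x)
  have : FiniteDimensional ℂ V := FiniteDimensional.span_of_finite ℂ (Set.finite_range x)
  let b := stdOrthonormalBasis ℂ V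
  let v : Fin s → V := fun j => ⟨x j, Submodule.subset_span ⟨j, rfl⟩⟩
  let u := fun l => (b l : H)
  have hu : Orthonormal ℂ u := b.orthonormal.comp_linearIsometry V.subtypeₗᵢ
  let a := fun l j => b.repr (v j) l
  have hx : ∀ j, x j = ∑ l, a l j • u l := fun j => by
    have h := congrArg (Subtype.val : V → H) (b.sum_repr (v j))
    rw [Submodule.coe_sum] at h
    exact h.symm
  have hnorm : ∀ j, ‖x j‖ ^ 2 = ∑ l, ‖a l j‖ ^ 2 := fun j => by
    rw [← EuclideanSpace.norm_sq_eq, b.repr.norm_map]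
    rfl
  have hcol : ∀ i, ∑ j, tensor ι H (M i j e) (x j) =
      ∑ l, tensor ι H (∑ j, M i j (a l j • e)) (u l) := fun i => by
    simp only [map_sum, sum_apply, map_smul, _root_.smul_apply]
    rw [Finset.sum_comm]
    refine Finset.sum_congr rfl fun j _ => ?_
    conv_lhs => rw [hx j]
    simp only [map_sum, map_smul]
  have hrow : ∀ l, ∑ i, ‖∑ j, M i j (a l j • e)‖ ^ 2 ≤
      ‖matrixOp M‖ ^ 2 * ∑ j, ‖a l j • e‖ ^ 2 := fun l => by
    let z : PiLp 2 (fun _ : Fin s => lp (fun _ : ι => ℂ) 2) :=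
      WithLp.toLp 2 fun j => a l j • e
    have h := pow_le_pow_left₀ (norm_nonneg _) ((matrixOp M).le_opNorm z) 2
    rw [mul_pow, PiLp.norm_sq_eq_of_L2, PiLp.norm_sq_eq_of_L2] at h
    simp only [matrixOp_apply] at h
    exact h
  calc ∑ i, ‖∑ j, tensor ι H (M i j e) (x j)‖ ^ 2
      = ∑ i, ∑ l, ‖∑ j, M i j (a l j • e)‖ ^ 2 :=
        Finset.sum_congr rfl fun i _ => by rw [hcol, norm_sq_sum_tensor _ hu]
    _ = ∑ l, ∑ i, ‖∑ j, M i j (a l j • e)‖ ^ 2 := Finset.sum_comm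
    _ ≤ ∑ l, ‖matrixOp M‖ ^ 2 * ∑ j, ‖a l j • e‖ ^ 2 := Finset.sum_le_sum fun l _ => hrow l
    _ = _ := by
        rw [← Finset.mul_sum, Finset.sum_comm, Finset.mul_sum (a := ‖e‖ ^ 2)]
        congr 1
        refine Finset.sum_congr rfl fun j _ => ?_
        rw [hnorm, Finset.mul_sum]
        refine Finset.sum_congr rfl fun l _ => ?_
        rw [norm_smul, mul_pow, mul_comm]

variable [CompleteSpace H]

/-- The map `f ↦ (x ↦ K* (f ⊗ x))` attached to an operator `K : H → ℓ² ⊗ H`. -/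
def synthesis (K : H →L[ℂ] lp (fun _ : ι => H) 2) : lp (fun _ : ι => ℂ) 2 →L[ℂ] H →L[ℂ] H :=
  ContinuousLinearMap.compL ℂ H (lp (fun _ : ι => H) 2) H (ContinuousLinearMap.adjoint K) ∘L
    tensor ι H

theorem synthesis_apply (K : H →L[ℂ] lp (fun _ : ι => H) 2) (f : lp (fun _ : ι => ℂ) 2) (x : H) :
    synthesis K f x = ContinuousLinearMap.adjoint K (tensor ι H f x) := rfl

theorem hasSum_adjoint {K : H →L[ℂ] lp (fun _ : ι => H) 2} {B : ι → H →L[ℂ] H}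
    (hK : ∀ x i, K x i = ContinuousLinearMap.adjoint (B i) x) (h : lp (fun _ : ι => H) 2) :
    HasSum (fun i => B i (h i)) (ContinuousLinearMap.adjoint K h) := by
  classical
  refine ((lp.hasSum_single (p := 2) (by simp) h).mapL (ContinuousLinearMap.adjoint K)).congr_fun
    fun i => ext_inner_left ℂ fun y => ?_
  rw [ContinuousLinearMap.adjoint_inner_right, lp.inner_single_right, hK,
    ContinuousLinearMap.adjoint_inner_left]

theorem exists_column {B : ι → H →L[ℂ] H} {C : ℝ} (hC : 0 ≤ C)
    (h : ∀ (s : Finset ι) (x : H),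
      ∑ i ∈ s, ‖ContinuousLinearMap.adjoint (B i) x‖ ^ 2 ≤ (C * ‖x‖) ^ 2) :
    ∃ K : H →L[ℂ] lp (fun _ : ι => H) 2, ∀ x i, K x i = ContinuousLinearMap.adjoint (B i) x :=
  ⟨LinearMap.mkContinuous
    { toFun := fun x => ⟨fun i => ContinuousLinearMap.adjoint (B i) x,
        memℓp_two_of_sum_sq_le fun s => h s x⟩
      map_add' := fun x y => by ext i; exact map_add _ _ _
      map_smul' := fun c x => by ext i; exact map_smul _ _ _ } C
    fun x => norm_le_of_sum_sq_le (mul_nonneg hC (norm_nonneg x)) fun s => h s x,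
    fun _ _ => rfl⟩

/-- Kept apart from the existence of `K` because the same kernel is later estimated with two
constants, the general one and the nilpotent one. -/
theorem norm_column_le {K : H →L[ℂ] lp (fun _ : ι => H) 2} {B : ι → H →L[ℂ] H}
    (hK : ∀ x i, K x i = ContinuousLinearMap.adjoint (B i) x) {C : ℝ} (hC : 0 ≤ C)
    (h : ∀ (s : Finset ι) (x : H),
      ∑ i ∈ s, ‖ContinuousLinearMap.adjoint (B i) x‖ ^ 2 ≤ (C * ‖x‖) ^ 2) : ‖K‖ ≤ C :=
  ContinuousLinearMap.opNorm_le_bound _ hC fun x =>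
    norm_le_of_sum_sq_le (mul_nonneg hC (norm_nonneg x)) fun s => by
      simpa only [hK] using h s x

theorem norm_matrixOp_synthesis_le {s : ℕ} (K : H →L[ℂ] lp (fun _ : ι => H) 2)
    (M : Matrix (Fin s) (Fin s) (lp (fun _ : ι => ℂ) 2 →L[ℂ] lp (fun _ : ι => ℂ) 2))
    {e : lp (fun _ : ι => ℂ) 2} (he : ‖e‖ = 1) (hM : ‖matrixOp M‖ ≤ 1) :
    ‖matrixOp (M.map fun A => synthesis K (A e))‖ ≤ ‖K‖ := by
  refine ContinuousLinearMap.opNorm_le_bound _ (norm_nonneg K) fun x => ?_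
  refine le_of_sq_le_sq ?_ (by positivity)
  rw [mul_pow, PiLp.norm_sq_eq_of_L2, PiLp.norm_sq_eq_of_L2]
  simp only [matrixOp_apply, Matrix.map_apply, synthesis_apply, ← map_sum]
  calc ∑ i, ‖ContinuousLinearMap.adjoint K (∑ j, tensor ι H (M i j e) (x j))‖ ^ 2
      ≤ ∑ i, ‖K‖ ^ 2 * ‖∑ j, tensor ι H (M i j e) (x j)‖ ^ 2 := by
        refine Finset.sum_le_sum fun i _ => ?_
        rw [← mul_pow, ← LinearIsometryEquiv.norm_map ContinuousLinearMap.adjoint K]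
        gcongr
        exact ContinuousLinearMap.le_opNorm _ _
    _ ≤ ‖K‖ ^ 2 * (1 ^ 2 * (1 ^ 2 * ∑ j, ‖x j‖ ^ 2)) := by
        rw [← Finset.mul_sum]
        refine mul_le_mul_of_nonneg_left ((sum_norm_sq_tensor_le M e fun j => x j).trans ?_)
          (sq_nonneg _)
        rw [he]
        gcongr
    _ = _ := by ring

end Tensor

/-! ### Fourier coefficients -/

section Fourier

variable {n : ℕ} {μ : Word n → ℝ} {A : Fock n →L[ℂ] Fock n} {c : Series n}

theorem toSeries_basisVec (α β : Word n) :
    toSeries μ (basisVec β) α = if α = β then ((weightProd μ β : ℝ) : ℂ)⁻¹ else 0 := by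
  rw [toSeries, basisVec_apply]
  by_cases h : α = β
  · simp [h]
  · simp [h]

/-- Only the factorization of `αβ` with right factor `β` meets the support of `e_β`. With
`apply_eq_zero` this determines every `A e_β` from the coefficients `c`. -/
theorem HasFourierSeries.apply_append (h : HasFourierSeries μ A c) (α β : Word n) :
    A (basisVec β) (α ++ β) / ((weightProd μ (α ++ β) : ℝ) : ℂ) =
      c α * ((weightProd μ β : ℝ) : ℂ)⁻¹ := by
  refine (congrFun (h (basisVec β)) (α ++ β)).trans ?_
  rw [seriesMul, Finset.sum_eq_single α.length]
  · simp [toSeries_basisVec]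
  · intro k hk hne
    rw [toSeries_basisVec, if_neg, mul_zero]
    intro h1
    have h2 := congrArg List.length h1
    simp only [List.length_drop, List.length_append, Finset.mem_range] at h2 hk
    omega
  · intro h1
    simp only [List.length_append, Finset.mem_range] at h1
    omega

theorem HasFourierSeries.apply_eq_zero (h : HasFourierSeries μ A c) (hμ : ∀ β, 0 < μ β)
    {β γ : Word n} (hγ : γ ∉ Set.range fun α => α ++ β) : A (basisVec β) γ = 0 := by
  have h1 : A (basisVec β) γ / ((weightProd μ γ : ℝ) : ℂ) = 0 := by
    refine (congrFun (h (basisVec β)) γ).trans (Finset.sum_eq_zero fun k _ => ?_)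
    rw [toSeries_basisVec, if_neg, mul_zero]
    intro h2
    exact hγ ⟨γ.take k, by simp only [← h2, List.take_append_drop]⟩
  have h2 : ((weightProd μ γ : ℝ) : ℂ) ≠ 0 := by exact_mod_cast (weightProd_pos hμ γ).ne'
  exact (div_eq_zero_iff.1 h1).resolve_right h2

end Fourier

/-! ### Cesàro means -/

theorem sum_range_sum_range_succ {M : Type*} [AddCommGroup M] [Module ℂ M] (G : ℕ → M) (N : ℕ) :
    ∑ j ∈ Finset.range N, ∑ k ∈ Finset.range (j + 1), G k =
      ∑ k ∈ Finset.range N, ((N : ℂ) - k) • G k := by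
  induction N with
  | zero => simp
  | succ N ih =>
    rw [Finset.sum_range_succ, ih, Finset.sum_range_succ, Finset.sum_range_succ, ← add_assoc,
      ← Finset.sum_add_distrib]
    congr 1
    · refine Finset.sum_congr rfl fun k _ => ?_
      push_cast
      module
    · push_cast
      module

theorem tendsto_sum_words {M : Type*} [AddCommGroup M] [TopologicalSpace M] {n : ℕ}
    {g : Word n → M} {L : M} (h : HasSum g L) :
    Tendsto (fun N => ∑ k ∈ Finset.range (N + 1), ∑ α ∈ wordsOfLength n k, g α) atTop (𝓝 L) := by
  have hdisj : ∀ N : ℕ, Set.PairwiseDisjoint (Finset.range (N + 1) : Set ℕ) (wordsOfLength n) := by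
    intro N j _ k _ hjk
    refine Finset.disjoint_left.2 fun α hα hα' => hjk ?_
    rw [mem_wordsOfLength] at hα hα'
    exact hα.symm.trans hα'
  have hmono : Tendsto (fun N => (Finset.range (N + 1)).biUnion (wordsOfLength n)) atTop atTop := by
    refine tendsto_atTop_finset_of_monotone (fun M N hMN => ?_) fun α => ⟨α.length, ?_⟩
    · exact Finset.biUnion_subset_biUnion_of_subset_left _ (by simpa using hMN)
    · simp [mem_wordsOfLength]
  refine (h.comp hmono).congr fun N => ?_
  exact Finset.sum_biUnion (hdisj N)

theorem tendsto_cesaroMean {H : Type*} [NormedAddCommGroup H] [InnerProductSpace ℂ H] {n : ℕ}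
    (T : Fin n → H →L[ℂ] H) (c : Word n → ℂ) {x L : H}
    (h : HasSum (fun α => c α • wordOp T α x) L) :
    Tendsto (fun N : ℕ => cesaroMean T c N x) atTop (𝓝 L) := by
  let _ : NormedSpace ℝ H := NormedSpace.restrictScalars ℝ ℂ H
  -- The average of the first `N + 1` partial sums by length counts a word of length `k` exactly `N
  -- + 1 - k` times, which gives the factor `1 - k / (N + 1)`.
  have h1 := ((tendsto_sum_words h).cesaro_smul).comp (tendsto_add_atTop_nat 1)
  refine h1.congr fun N => ?_
  have hN : (N : ℂ) + 1 ≠ 0 := by exact_mod_cast Nat.succ_ne_zero N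
  simp only [Function.comp, sum_range_sum_range_succ, cesaroMean, polyOp, sum_apply]
  rw [Finset.smul_sum]
  refine Finset.sum_congr rfl fun k _ => ?_
  rw [Finset.smul_sum, Finset.smul_sum]
  refine Finset.sum_congr rfl fun α hα => ?_
  rw [mem_wordsOfLength] at hα
  rw [_root_.smul_apply, hα, ← Complex.coe_smul, smul_smul, smul_smul]
  congr 1
  push_cast
  field_simp

/-! ### The functional calculus -/

section Calculus

variable {H : Type*} [NormedAddCommGroup H] [InnerProductSpace ℂ H] [CompleteSpace H]
variable {n : ℕ} {μ : Word n → ℝ} {T : Fin n → H →L[ℂ] H}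
variable {K : H →L[ℂ] lp (fun _ : Word n => H) 2}

/-- The operator `T_α / μ(α)` with `μ(α) = weightProd μ α`. -/
def scaledWordOp (μ : Word n → ℝ) (T : Fin n → H →L[ℂ] H) (α : Word n) : H →L[ℂ] H :=
  ((weightProd μ α : ℝ) : ℂ)⁻¹ • wordOp T α

theorem adjoint_scaledWordOp (μ : Word n → ℝ) (T : Fin n → H →L[ℂ] H) (α : Word n) :
    ContinuousLinearMap.adjoint (scaledWordOp μ T α) =
      ((weightProd μ α : ℝ) : ℂ)⁻¹ • ContinuousLinearMap.adjoint (wordOp T α) := by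
  rw [scaledWordOp, map_smulₛₗ, map_inv₀, Complex.conj_ofReal]

theorem norm_sq_adjoint_scaledWordOp (μ : Word n → ℝ) (T : Fin n → H →L[ℂ] H) (α : Word n)
    (x : H) : ‖ContinuousLinearMap.adjoint (scaledWordOp μ T α) x‖ ^ 2 =
      (weightProd μ α ^ 2)⁻¹ * ‖ContinuousLinearMap.adjoint (wordOp T α) x‖ ^ 2 := by
  rw [adjoint_scaledWordOp, _root_.smul_apply, norm_smul, mul_pow, norm_inv, Complex.norm_real,
    inv_pow, Real.norm_eq_abs, sq_abs]

/-- `K` is the noncommutative Poisson kernel `x ↦ ∑ e_α ⊗ T_α* x / μ(α)`. -/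
def IsPoissonKernel (μ : Word n → ℝ) (T : Fin n → H →L[ℂ] H)
    (K : H →L[ℂ] lp (fun _ : Word n => H) 2) : Prop :=
  ∀ x α, K x α = ContinuousLinearMap.adjoint (scaledWordOp μ T α) x

theorem IsPoissonKernel.hasSum_synthesis (hK : IsPoissonKernel μ T K) (f : Fock n) (x : H) :
    HasSum (fun α => (f α / ((weightProd μ α : ℝ) : ℂ)) • wordOp T α x) (synthesis K f x) := by
  refine (hasSum_adjoint hK (tensor _ _ f x)).congr_fun fun α => ?_
  rw [tensor_apply, scaledWordOp, _root_.smul_apply, map_smul, smul_smul, div_eq_inv_mul]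

theorem IsPoissonKernel.synthesis_basisVec (hK : IsPoissonKernel μ T K) (β : Word n) :
    synthesis K (basisVec β) = ((weightProd μ β : ℝ) : ℂ)⁻¹ • wordOp T β := by
  ext x
  refine (hK.hasSum_synthesis (basisVec β) x).unique ?_
  have h := hasSum_single (f := fun α => (basisVec β α / ((weightProd μ α : ℝ) : ℂ)) •
    wordOp T α x) β fun α hα => by simp [basisVec_apply, hα]
  simpa [basisVec_apply] using h

theorem IsPoissonKernel.hasSum_fourier (hK : IsPoissonKernel μ T K) {A : Fock n →L[ℂ] Fock n}
    {c : Series n} (hA : HasFourierSeries μ A c) (x : H) :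
    HasSum (fun α => c α • wordOp T α x) (synthesis K (A (basisVec [])) x) := by
  refine (hK.hasSum_synthesis (A (basisVec [])) x).congr_fun fun α => ?_
  have h := hA.apply_append α []
  simp only [List.append_nil, weightProd, Complex.ofReal_one, inv_one, mul_one] at h
  rw [h]

/-- Both sides are bounded and linear in `f`, so `f = e_β` suffices. There `A e_β` lives on the
words `αβ`, with coefficients `c_α / μ(β)` relative to `μ(αβ)`, and `T_{αβ} = T_α T_β`. -/
theorem IsPoissonKernel.synthesis_apply_mul (hK : IsPoissonKernel μ T K) (hμ : ∀ β, 0 < μ β)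
    {A : Fock n →L[ℂ] Fock n} (hA : A ∈ hardyAlgebra μ) (f : Fock n) :
    synthesis K (A f) = synthesis K (A (basisVec [])) * synthesis K f := by
  obtain ⟨c, hc⟩ := hA
  have key : synthesis K ∘L A =
      ContinuousLinearMap.compL ℂ H H H (synthesis K (A (basisVec []))) ∘L synthesis K := by
    refine clm_ext_basisVec fun β => ?_
    ext x
    change synthesis K (A (basisVec β)) x =
      synthesis K (A (basisVec [])) (synthesis K (basisVec β) x)
    refine (hK.hasSum_synthesis (A (basisVec β)) x).unique ?_
    have hinj : Function.Injective fun α : Word n => α ++ β := List.append_left_injective β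
    refine (hinj.hasSum_iff fun γ hγ => ?_).1 ?_
    · rw [hc.apply_eq_zero hμ hγ, zero_div, zero_smul]
    · refine (hK.hasSum_fourier hc (synthesis K (basisVec β) x)).congr_fun fun α => ?_
      rw [Function.comp_apply, hc.apply_append, hK.synthesis_basisVec, _root_.smul_apply, map_smul,
        smul_smul, wordOp_append]
      rfl
  exact congrArg (fun B => B f) key

/-- The functional calculus `φ(W) ↦ φ(T)`. -/
def functionalCalculus (hK : IsPoissonKernel μ T K) (hμ : ∀ β, 0 < μ β) :
    hardyAlgebra μ →ₐ[ℂ] (H →L[ℂ] H) :=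
  AlgHom.ofLinearMap
    { toFun := fun A => synthesis K ((A : Fock n →L[ℂ] Fock n) (basisVec []))
      map_add' := fun A B => map_add (synthesis K) _ _
      map_smul' := fun c A => map_smul (synthesis K) c _ }
    ((hK.synthesis_basisVec []).trans (by simp [weightProd, wordOp_nil]))
    fun A B => hK.synthesis_apply_mul hμ A.2 ((B : Fock n →L[ℂ] Fock n) (basisVec []))

theorem functionalCalculus_apply (hK : IsPoissonKernel μ T K) (hμ : ∀ β, 0 < μ β)
    (A : hardyAlgebra μ) : functionalCalculus hK hμ A =
      synthesis K ((A : Fock n →L[ℂ] Fock n) (basisVec [])) := rfl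

theorem norm_functionalCalculus_le (hK : IsPoissonKernel μ T K) (hμ : ∀ β, 0 < μ β)
    (A : hardyAlgebra μ) : ‖functionalCalculus hK hμ A‖ ≤
      ‖synthesis K‖ * ‖(A : Fock n →L[ℂ] Fock n)‖ := by
  refine ((synthesis K).le_opNorm _).trans ?_
  gcongr
  simpa [norm_basisVec] using (A : Fock n →L[ℂ] Fock n).le_opNorm (basisVec [])

theorem cbNorm_functionalCalculus_le (hK : IsPoissonKernel μ T K) (hμ : ∀ β, 0 < μ β) :
    cbNorm (functionalCalculus hK hμ).toLinearMap ≤ ENNReal.ofReal ‖K‖ := by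
  refine iSup_le fun s => iSup_le fun A => iSup_le fun hA => ?_
  rw [← ofReal_norm]
  exact ENNReal.ofReal_le_ofReal (norm_matrixOp_synthesis_le K
    (A.map fun a : hardyAlgebra μ => (a : Fock n →L[ℂ] Fock n)) (norm_basisVec []) hA)

theorem functionalCalculus_generator (hK : IsPoissonKernel μ T K) (hμ : ∀ β, 0 < μ β)
    {W : Fin n → Fock n →L[ℂ] Fock n} (hW : IsWeightedLeftMultiShift μ W) (i : Fin n) :
    functionalCalculus hK hμ ⟨W i, _, hW.hasFourierSeries hμ i⟩ = T i := by
  rw [functionalCalculus_apply, hW, map_smul, hK.synthesis_basisVec, smul_smul]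
  have h : ((μ [i] : ℝ) : ℂ) ≠ 0 := by exact_mod_cast (hμ _).ne'
  simp [weightProd, h, wordOp]

theorem functionalCalculus_polynomial (hK : IsPoissonKernel μ T K) (hμ : ∀ β, 0 < μ β)
    {W : Fin n → Fock n →L[ℂ] Fock n} (hW : IsWeightedLeftMultiShift μ W) (m : ℕ)
    (c : Word n → ℂ) : ∃ h : polyOp W c m ∈ hardyAlgebra μ,
      functionalCalculus hK hμ ⟨polyOp W c m, h⟩ = polyOp T c m := by
  let V : Fin n → hardyAlgebra μ := fun i => ⟨W i, _, hW.hasFourierSeries hμ i⟩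
  let P : hardyAlgebra μ :=
    ∑ k ∈ Finset.range (m + 1), ∑ α ∈ wordsOfLength n k, c α • (α.map V).prod
  have hcoe : ∀ α : Word n, (hardyAlgebra μ).val (α.map V).prod = wordOp W α := fun α => by
    rw [map_list_prod, List.map_map]
    rfl
  have hmap : ∀ α : Word n, functionalCalculus hK hμ (α.map V).prod = wordOp T α := fun α => by
    rw [map_list_prod, List.map_map, wordOp]
    congr 2
    funext i
    exact functionalCalculus_generator hK hμ hW i
  have hP : (hardyAlgebra μ).val P = polyOp W c m := by
    simp only [P, map_sum, map_smul, hcoe, polyOp]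
  refine ⟨hP ▸ P.2, ?_⟩
  have h1 : (⟨polyOp W c m, hP ▸ P.2⟩ : hardyAlgebra μ) = P := Subtype.ext hP.symm
  rw [h1]
  simp only [P, map_sum, map_smul, hmap, polyOp]

theorem tendsto_inner_functionalCalculus (hK : IsPoissonKernel μ T K) (hμ : ∀ β, 0 < μ β)
    {A : ℕ → hardyAlgebra μ} {B : hardyAlgebra μ}
    (h : ∀ f g : Fock n, Tendsto (fun k => ⟪g, (A k : Fock n →L[ℂ] Fock n) f⟫_ℂ) atTop
      (𝓝 ⟪g, (B : Fock n →L[ℂ] Fock n) f⟫_ℂ)) (x y : H) :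
    Tendsto (fun k => ⟪y, functionalCalculus hK hμ (A k) x⟫_ℂ) atTop
      (𝓝 ⟪y, functionalCalculus hK hμ B x⟫_ℂ) := by
  -- By Riesz, `φ` is the inner product with a fixed vector, so the hypothesis is only needed at `f
  -- = e_∅` and that vector.
  let φ : Fock n →L[ℂ] ℂ := innerSL ℂ y ∘L (synthesis K).flip x
  have hφ : ∀ f, ⟪(InnerProductSpace.toDual ℂ (Fock n)).symm φ, f⟫_ℂ = ⟪y, synthesis K f x⟫_ℂ :=
    fun f => InnerProductSpace.toDual_symm_apply
  simp only [functionalCalculus_apply, ← hφ]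
  exact h _ _

theorem tendsto_functionalCalculus_apply (hK : IsPoissonKernel μ T K) (hμ : ∀ β, 0 < μ β)
    {A : ℕ → hardyAlgebra μ} {B : hardyAlgebra μ}
    (h : ∀ f : Fock n, Tendsto (fun k => (A k : Fock n →L[ℂ] Fock n) f) atTop
      (𝓝 ((B : Fock n →L[ℂ] Fock n) f))) (x : H) :
    Tendsto (fun k => functionalCalculus hK hμ (A k) x) atTop
      (𝓝 (functionalCalculus hK hμ B x)) :=
  (((synthesis K).flip x).continuous.tendsto _).comp (h (basisVec []))

theorem continuous_inner_weakStar {L : Type*} [NormedAddCommGroup L] [InnerProductSpace ℂ L]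
    (f g : L) : @Continuous (L →L[ℂ] L) ℂ (weakStarTopology L) _ fun A => ⟪g, A f⟫_ℂ := by
  have h : Continuous[TopologicalSpace.induced (fun A : L →L[ℂ] L =>
      ∑' k, ⟪lp.single (E := fun _ : ℕ => L) 2 0 g k,
        A (lp.single (E := fun _ : ℕ => L) 2 0 f k)⟫_ℂ) inferInstance, inferInstance]
      (fun A : L →L[ℂ] L => ∑' k, ⟪lp.single (E := fun _ : ℕ => L) 2 0 g k,
        A (lp.single (E := fun _ : ℕ => L) 2 0 f k)⟫_ℂ) := continuous_induced_dom
  have hle : weakStarTopology L ≤ TopologicalSpace.induced (fun A : L →L[ℂ] L =>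
      ∑' k, ⟪lp.single (E := fun _ : ℕ => L) 2 0 g k,
        A (lp.single (E := fun _ : ℕ => L) 2 0 f k)⟫_ℂ) inferInstance :=
    (iInf_le _ _).trans (iInf_le _ _)
  have h2 := continuous_le_dom hle h
  have h3 : (fun A : L →L[ℂ] L => ∑' k, ⟪lp.single (E := fun _ : ℕ => L) 2 0 g k,
      A (lp.single (E := fun _ : ℕ => L) 2 0 f k)⟫_ℂ) = fun A => ⟪g, A f⟫_ℂ := by
    funext A
    rw [tsum_eq_single 0]
    · rw [lp.single_apply_self, lp.single_apply_self]
    · intro k hk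
      rw [lp.single_apply_ne _ _ _ hk, inner_zero_left]
  rw [h3] at h2
  exact h2

/-- By Cauchy–Schwarz for `‖x k‖` and `‖y k‖`, the functionals `φ k` are norm summable. Hence an
ultraweak functional composed with `Ψ` is a single vector functional `A ↦ ⟪g, A e_∅⟫`. -/
theorem continuous_functionalCalculus_weakStar (hK : IsPoissonKernel μ T K)
    (hμ : ∀ β, 0 < μ β) :
    @Continuous (hardyAlgebra μ) (H →L[ℂ] H)
      (TopologicalSpace.induced Subtype.val (weakStarTopology (Fock n)))
      (weakStarTopology H) (functionalCalculus hK hμ) := by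
  refine continuous_iInf_rng.2 fun x => continuous_iInf_rng.2 fun y => continuous_induced_rng.2 ?_
  let φ : ℕ → Fock n →L[ℂ] ℂ := fun k => innerSL ℂ (y k) ∘L (synthesis K).flip (x k)
  have hbound : ∀ k, ‖φ k‖ ≤ ‖synthesis K‖ * (‖y k‖ * ‖x k‖) := fun k => by
    refine (ContinuousLinearMap.opNorm_comp_le _ _).trans ?_
    rw [innerSL_apply_norm]
    have h := (synthesis K).flip.le_opNorm (x k)
    rw [ContinuousLinearMap.opNorm_flip] at h
    calc ‖y k‖ * ‖(synthesis K).flip (x k)‖ ≤ ‖y k‖ * (‖synthesis K‖ * ‖x k‖) := by gcongr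
      _ = _ := by ring
  have hxy : Summable fun k => ‖y k‖ * ‖x k‖ :=
    lp.summable_mul (p := 2) (q := 2)
      (by simpa using (Real.HolderConjugate.two_two : (2 : ℝ).HolderConjugate 2)) y x
  have hsum : Summable φ := Summable.of_norm_bounded (hxy.mul_left _) hbound
  have hφ : ∀ f, ⟪(InnerProductSpace.toDual ℂ (Fock n)).symm (∑' k, φ k), f⟫_ℂ =
      ∑' k, ⟪y k, synthesis K f (x k)⟫_ℂ := fun f => by
    rw [InnerProductSpace.toDual_symm_apply]
    exact (hsum.hasSum.mapL (ContinuousLinearMap.apply ℂ ℂ f)).tsum_eq.symm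
  have h := @Continuous.comp _ _ _ (TopologicalSpace.induced Subtype.val
      (weakStarTopology (Fock n))) (weakStarTopology (Fock n)) _ _ _
    (continuous_inner_weakStar (basisVec [])
      ((InnerProductSpace.toDual ℂ (Fock n)).symm (∑' k, φ k)))
    (continuous_induced_dom (f := (Subtype.val : hardyAlgebra μ → Fock n →L[ℂ] Fock n)))
  simp only [Function.comp_def, hφ] at h
  exact h

/-- Gelfand's formula applied to `‖Φ(A)^k‖ ≤ C ‖A^k‖`; the constant disappears because `C^{1/k} →
1`, once it is replaced by `max C 1 > 0`. -/
theorem spectralRadius_le_of_norm_le {L : Type*} [NormedAddCommGroup L] [InnerProductSpace ℂ L]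
    [CompleteSpace L] {S : Subalgebra ℂ (L →L[ℂ] L)} (Φ : S →ₐ[ℂ] (H →L[ℂ] H)) {C : ℝ}
    (hC : ∀ A : S, ‖Φ A‖ ≤ C * ‖(A : L →L[ℂ] L)‖) (A : S) :
    spectralRadius ℂ (Φ A) ≤ spectralRadius ℂ (A : L →L[ℂ] L) := by
  have hC' : 0 < max C 1 := lt_of_lt_of_le one_pos (le_max_right _ _)
  have h1 := spectrum.pow_norm_pow_one_div_tendsto_nhds_spectralRadius (Φ A)
  have h2 := spectrum.pow_norm_pow_one_div_tendsto_nhds_spectralRadius (A : L →L[ℂ] L)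
  have h3 : Tendsto (fun k : ℕ => ENNReal.ofReal (max C 1 ^ (1 / (k : ℝ)))) atTop (𝓝 1) := by
    have h := ENNReal.tendsto_ofReal
      (((Real.continuous_const_rpow hC'.ne').tendsto 0).comp tendsto_one_div_atTop_nhds_zero_nat)
    simpa using h
  have h4 := ENNReal.Tendsto.mul h3 (Or.inl one_ne_zero) h2 (Or.inr ENNReal.one_ne_top)
  rw [one_mul] at h4
  refine le_of_tendsto_of_tendsto' h1 h4 fun k => ?_
  rw [← ENNReal.ofReal_mul (Real.rpow_nonneg hC'.le _), ← Real.mul_rpow hC'.le (norm_nonneg _)]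
  refine ENNReal.ofReal_le_ofReal (Real.rpow_le_rpow (norm_nonneg _) ?_ (by positivity))
  have h5 := hC (A ^ k)
  rw [map_pow] at h5
  exact h5.trans (mul_le_mul_of_nonneg_right (le_max_left _ _) (norm_nonneg _))

theorem IsPoissonKernel.hasSum_adjoint_comp_self (hK : IsPoissonKernel μ T K) (x : H) :
    HasSum (fun α => (((weightProd μ α ^ 2)⁻¹ : ℝ) : ℂ) •
      wordOp T α (ContinuousLinearMap.adjoint (wordOp T α) x))
      ((ContinuousLinearMap.adjoint K ∘L K) x) := by
  refine (hasSum_adjoint hK (K x)).congr_fun fun α => ?_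
  rw [hK, adjoint_scaledWordOp, scaledWordOp, _root_.smul_apply, _root_.smul_apply, map_smul,
    smul_smul]
  congr 1
  push_cast
  rw [sq, mul_inv]

end Calculus

/-! ### Row bounds for weights depending only on the length -/

section RowBound

variable {H : Type*} [NormedAddCommGroup H] [InnerProductSpace ℂ H] [CompleteSpace H]
variable {n : ℕ} {w : ℕ → ℝ}

theorem sum_norm_sq_adjoint_scaledWordOp_le (T : Fin n → H →L[ℂ] H) (h0 : w 0 = 1)
    (hpos : ∀ k, 0 < w k) {C : ℝ}
    (hC : ∀ N, ∑ k ∈ Finset.range N, (w k ^ 2)⁻¹ * rowNorm T k ^ 2 ≤ C ^ 2)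
    (s : Finset (Word n)) (x : H) :
    ∑ α ∈ s, ‖ContinuousLinearMap.adjoint (scaledWordOp (lengthWeight n w) T α) x‖ ^ 2 ≤
      (C * ‖x‖) ^ 2 := by
  obtain ⟨N, hN⟩ : ∃ N, ∀ α ∈ s, α.length < N :=
    ⟨s.sup List.length + 1, fun α hα => Nat.lt_succ_of_le (Finset.le_sup (f := List.length) hα)⟩
  rw [← Finset.sum_fiberwise_of_maps_to (t := Finset.range N) (g := List.length)
    fun α hα => Finset.mem_range.2 (hN α hα)]
  calc _ ≤ ∑ k ∈ Finset.range N, (w k ^ 2)⁻¹ * rowNorm T k ^ 2 * ‖x‖ ^ 2 := by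
        refine Finset.sum_le_sum fun k _ => ?_
        rw [mul_assoc]
        refine le_trans ?_ (mul_le_mul_of_nonneg_left (sum_norm_sq_adjoint_wordOp_le T k x)
          (by positivity))
        rw [Finset.mul_sum]
        refine (Finset.sum_le_sum_of_subset_of_nonneg (t := wordsOfLength n k) ?_
          fun _ _ _ => by positivity).trans (Finset.sum_le_sum fun α hα => ?_)
        · intro α hα
          exact mem_wordsOfLength.2 (Finset.mem_filter.1 hα).2
        · rw [norm_sq_adjoint_scaledWordOp, weightProd_lengthWeight h0 hpos,
            mem_wordsOfLength.1 hα]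
    _ ≤ (C * ‖x‖) ^ 2 := by
        rw [← Finset.sum_mul, mul_pow]
        exact mul_le_mul_of_nonneg_right (hC N) (sq_nonneg _)

theorem inv_regularization_sq_mul_le {a : ℕ → ℝ} (h0 : ∀ k, 0 ≤ a k) (k : ℕ) :
    (regularization a k ^ 2)⁻¹ * a k ^ 2 ≤ 1 / ((k : ℝ) + 1) ^ 2 := by
  have hk : (0 : ℝ) < ((k : ℝ) + 1) ^ 2 := by positivity
  rw [inv_mul_eq_div, div_le_div_iff₀ (pow_pos (regularization_pos a k) 2) hk, one_mul, mul_comm,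
    ← mul_pow]
  exact pow_le_pow_left₀ (mul_nonneg (by positivity) (h0 k)) (le_regularization a k) 2

theorem sum_inv_sq_le (N : ℕ) :
    ∑ k ∈ Finset.range N, 1 / ((k : ℝ) + 1) ^ 2 ≤ (Real.pi / √6) ^ 2 := by
  rw [div_pow, Real.sq_sqrt (by norm_num)]
  have h := sum_le_hasSum (Finset.range (N + 1)) (fun _ _ => by positivity) hasSum_zeta_two
  -- The zeta sum starts at index `0`, where the term `1 / 0 ^ 2` is `0`; dropping it shifts the
  -- index.
  rw [Finset.sum_range_succ'] at h
  simpa using h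

theorem IsNilpotentOfOrder.rowNorm_eq_zero {T : Fin n → H →L[ℂ] H} {m : ℕ}
    (hT : IsNilpotentOfOrder T m) {k : ℕ} (hk : m ≤ k) : rowNorm T k = 0 := by
  have h : rowNorm T m = 0 := by
    rw [rowNorm, Finset.sum_eq_zero fun α hα => ?_, norm_zero, Real.sqrt_zero]
    rw [hT.1 α (mem_wordsOfLength.1 hα), zero_mul]
  have h2 := rowNorm_submultiplicative T m (k - m)
  rw [h, zero_mul, Nat.add_sub_cancel' hk] at h2
  exact h2.antisymm (rowNorm_nonneg T k)

theorem IsNilpotentOfOrder.sum_inv_regularization_le {T : Fin n → H →L[ℂ] H} {m : ℕ}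
    (hT : IsNilpotentOfOrder T m) (N : ℕ) :
    ∑ k ∈ Finset.range N, (regularization (rowNorm T) k ^ 2)⁻¹ * rowNorm T k ^ 2 ≤
      ∑ k ∈ Finset.range m, 1 / ((k : ℝ) + 1) ^ 2 := by
  calc _ ≤ ∑ k ∈ Finset.range (N + m),
        (regularization (rowNorm T) k ^ 2)⁻¹ * rowNorm T k ^ 2 :=
        Finset.sum_le_sum_of_subset_of_nonneg (by simp) fun _ _ _ => by positivity
    _ = ∑ k ∈ Finset.range m, (regularization (rowNorm T) k ^ 2)⁻¹ * rowNorm T k ^ 2 := by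
        refine (Finset.sum_subset (by simp) fun k _ hk => ?_).symm
        rw [hT.rowNorm_eq_zero (by simpa using hk)]
        simp
    _ ≤ _ := Finset.sum_le_sum fun k _ => inv_regularization_sq_mul_le (rowNorm_nonneg T) k

end RowBound

end MultiShift

end

theorem theorem5p2 {H : Type*} [NormedAddCommGroup H] [InnerProductSpace ℂ H] [CompleteSpace H]
    (n : ℕ) (T : Fin n → H →L[ℂ] H) :
    ∃ (μ : MultiShift.Word n → ℝ)
      (W : Fin n → MultiShift.Fock n →L[ℂ] MultiShift.Fock n),
      MultiShift.IsAdmissibleWeight μ ∧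
      MultiShift.IsWeightedLeftMultiShift μ W ∧
      (∃ r : ℝ, MultiShift.HasJointSpectralRadius T r ∧ MultiShift.HasJointSpectralRadius W r) ∧
      ∃ Ψ : MultiShift.hardyAlgebra μ →ₐ[ℂ] (H →L[ℂ] H),
        -- `Ψ` is given by the strong limits of the Cesàro means
        (∀ (A : MultiShift.hardyAlgebra μ) (c : MultiShift.Series n),
          MultiShift.HasFourierSeries μ A c →
            ∀ x : H, Tendsto (fun N : ℕ => MultiShift.cesaroMean T c N x) atTop (𝓝 (Ψ A x))) ∧
        -- values on polynomials
        (∀ (m : ℕ) (c : MultiShift.Word n → ℂ),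
          ∃ h : MultiShift.polyOp W c m ∈ MultiShift.hardyAlgebra μ,
            Ψ ⟨MultiShift.polyOp W c m, h⟩ = MultiShift.polyOp T c m) ∧
        -- sequential WOT-continuity
        (∀ (A : ℕ → MultiShift.hardyAlgebra μ) (B : MultiShift.hardyAlgebra μ),
          (∀ f g : MultiShift.Fock n,
            Tendsto (fun k => ⟪g, (A k : MultiShift.Fock n →L[ℂ] MultiShift.Fock n) f⟫_ℂ) atTop
              (𝓝 ⟪g, (B : MultiShift.Fock n →L[ℂ] MultiShift.Fock n) f⟫_ℂ)) →
          ∀ x y : H, Tendsto (fun k => ⟪y, Ψ (A k) x⟫_ℂ) atTop (𝓝 ⟪y, Ψ B x⟫_ℂ)) ∧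
        -- sequential SOT-continuity
        (∀ (A : ℕ → MultiShift.hardyAlgebra μ) (B : MultiShift.hardyAlgebra μ),
          (∀ f : MultiShift.Fock n,
            Tendsto (fun k => (A k : MultiShift.Fock n →L[ℂ] MultiShift.Fock n) f) atTop
              (𝓝 ((B : MultiShift.Fock n →L[ℂ] MultiShift.Fock n) f))) →
          ∀ x : H, Tendsto (fun k => Ψ (A k) x) atTop (𝓝 (Ψ B x))) ∧
        -- the series `∑ μ(α)⁻² T_α T_α^*` converges strongly and bounds the cb-norm
        (∃ S : H →L[ℂ] H,
          (∀ x : H, HasSum (fun α : MultiShift.Word n =>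
            (((MultiShift.weightProd μ α ^ 2)⁻¹ : ℝ) : ℂ) •
              MultiShift.wordOp T α
                (ContinuousLinearMap.adjoint (MultiShift.wordOp T α) x)) (S x)) ∧
          MultiShift.cbNorm Ψ.toLinearMap ≤ ENNReal.ofReal (Real.sqrt ‖S‖)) ∧
        -- weak-star continuity
        @Continuous (MultiShift.hardyAlgebra μ) (H →L[ℂ] H)
          (TopologicalSpace.induced Subtype.val
            (MultiShift.weakStarTopology (MultiShift.Fock n)))
          (MultiShift.weakStarTopology H) Ψ ∧
        -- spectral radii
        (∀ A : MultiShift.hardyAlgebra μ,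
          spectralRadius ℂ (Ψ A) ≤
            spectralRadius ℂ (A : MultiShift.Fock n →L[ℂ] MultiShift.Fock n)) ∧
        -- the absolute bounds on the cb-norm
        MultiShift.cbNorm Ψ.toLinearMap ≤ ENNReal.ofReal (Real.pi / Real.sqrt 6) ∧
        (∀ m : ℕ, MultiShift.IsNilpotentOfOrder T m →
          MultiShift.cbNorm Ψ.toLinearMap ≤
            ENNReal.ofReal (Real.sqrt (∑ k ∈ Finset.range m, 1 / ((k : ℝ) + 1) ^ 2))) := by
  let w := MultiShift.regularization (MultiShift.rowNorm T)
  have h0 : w 0 = 1 := MultiShift.regularization_zero (MultiShift.rowNorm_zero_le_one T)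
  have hpos : ∀ k, 0 < w k := MultiShift.regularization_pos _
  have hmul : ∀ j k, w (j + k) ≤ w j * w k := MultiShift.regularization_submultiplicative
    (MultiShift.rowNorm_nonneg T) (MultiShift.rowNorm_submultiplicative T)
  let μ := MultiShift.lengthWeight n w
  have hμ : ∀ β, 0 < μ β := MultiShift.lengthWeight_pos hpos
  have hadm : MultiShift.IsAdmissibleWeight μ :=
    MultiShift.isAdmissibleWeight_lengthWeight h0 hpos hmul
  obtain ⟨W, hW⟩ := MultiShift.exists_isWeightedLeftMultiShift hadm
  have hπ : 0 ≤ Real.pi / √6 := by positivity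
  have hrow := MultiShift.sum_norm_sq_adjoint_scaledWordOp_le T h0 hpos (C := Real.pi / √6)
    fun N => (Finset.sum_le_sum fun k _ => MultiShift.inv_regularization_sq_mul_le
      (MultiShift.rowNorm_nonneg T) k).trans (MultiShift.sum_inv_sq_le N)
  obtain ⟨K, hK⟩ : ∃ K, MultiShift.IsPoissonKernel μ T K := MultiShift.exists_column hπ hrow
  have hcb := MultiShift.cbNorm_functionalCalculus_le hK hμ
  refine ⟨μ, W, hadm, hW, ?_, MultiShift.functionalCalculus hK hμ,
    fun A c hc x => MultiShift.tendsto_cesaroMean T c (hK.hasSum_fourier hc x),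
    MultiShift.functionalCalculus_polynomial hK hμ hW,
    fun A B h => MultiShift.tendsto_inner_functionalCalculus hK hμ h,
    fun A B h => MultiShift.tendsto_functionalCalculus_apply hK hμ h,
    ⟨ContinuousLinearMap.adjoint K ∘L K, hK.hasSum_adjoint_comp_self, ?_⟩,
    MultiShift.continuous_functionalCalculus_weakStar hK hμ,
    MultiShift.spectralRadius_le_of_norm_le _ (MultiShift.norm_functionalCalculus_le hK hμ),
    hcb.trans (ENNReal.ofReal_le_ofReal (MultiShift.norm_column_le hK hπ hrow)), fun m hm => ?_⟩
  · obtain ⟨r, hr, hTr⟩ := MultiShift.exists_hasJointSpectralRadius T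
    -- Without letters the rows of `W` of positive length are empty, so their norms are `0` and not
    -- `w k`; both radii are then `0`.
    rcases eq_or_ne n 0 with rfl | hn
    · exact ⟨0, MultiShift.hasJointSpectralRadius_of_no_letters T,
        MultiShift.hasJointSpectralRadius_of_no_letters W⟩
    · refine ⟨r, hTr, ?_⟩
      rw [MultiShift.hasJointSpectralRadius_iff] at hTr ⊢
      have h := MultiShift.tendsto_root_regularization (MultiShift.rowNorm_nonneg T) hr hTr
      refine h.congr fun k => ?_
      rw [(MultiShift.rowNorm_weightedLeftMultiShift_le h0 hpos hmul hW k).antisymm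
        (MultiShift.le_rowNorm_weightedLeftMultiShift hn h0 hpos hW k)]
  · rwa [ContinuousLinearMap.norm_adjoint_comp_self, Real.sqrt_mul_self (norm_nonneg K)]
  · have hS : 0 ≤ ∑ k ∈ Finset.range m, 1 / ((k : ℝ) + 1) ^ 2 := by positivity
    refine hcb.trans (ENNReal.ofReal_le_ofReal (MultiShift.norm_column_le hK (Real.sqrt_nonneg _)
      (MultiShift.sum_norm_sq_adjoint_scaledWordOp_le T h0 hpos fun N => ?_)))
    rw [Real.sq_sqrt hS]
    exact hm.sum_inv_regularization_le N
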